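/- Let $d$ be a natural number, let $\mathbb T^d=\mathbb R^d/\mathbb Z^d$ carry normalised Lebesgue measure, and write $\|\cdot\|$ for the norm of $L^2=L^2(\mathbb T^d;\mathbb C)$ and $\hat h(k)$, $k\in\mathbb Z^d$, for the Fourier coefficients of $h$ with respect to $e_k(x)=e^{2\pi i k\cdot x}$. For $N,R\ge 0$ let $\Pi_{\le N}$ and $\Pi_{\ge R}$ be the orthogonal projections of $L^2$ onto the closed spans of the modes $e_k$ with $|k|\le N$, respectively $|k|\ge R$ (with $|k|$ the Euclidean length), and let $\|h\|_{H^{-1}}^2=\sum_{k\ne 0}|k|^{-2}|\hat h(k)|^2$. Let $f:\mathbb T^d\to\mathbb T^d$ be a $C^\infty$ diffeomorphism preserving volume. For $\kappa\ge 0$ put $\mathcal L_{f,\kappa}h=e^{\kappa\Delta}(h\circ f^{-1})$, where $e^{\kappa\Delta}$ is the heat semigroup (multiplication of $\hat h(k)$ by $e^{-4\pi^2|k|^2\kappa}$), and put $$\Lambda=\log\sup_{x\in\mathbb T^d}|(Df_x)^{-1}|,$$ with the Euclidean operator norm. Let $\gamma>0$ and assume that $f$ exhibits $\kappa$-uniform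 $H^{-1}$ decay at rate $\gamma$: for every smooth mean-zero $h:\mathbb T^d\to\mathbb R$ there is $C_h>0$ such that $\|\mathcal L_{f,\kappa}^n h\|_{H^{-1}}\le C_h e^{-\gamma n}$ for all $\kappa\ge 0$ and all $n\ge 1$. Let $b\in C^\infty(\mathbb T^d;\mathbb C)$ have mean zero and $\|b\|=1$, let $\nu$ be a probability law on $\mathbb R$ with mean $0$ and variance $1$, and let $(\omega_n)$ be i.i.d. with law $\nu$. Consider, on the mean-zero functions in $L^2$, the Markov chain $g_{n+1}=\mathcal L_{f,\kappa}g_n+\omega_{n+1}b$. Let $(\eta_n)_{n\ge 0}$ be an i.i.d. sequence with law $\nu$ on some probability space. Then: (i) For every $\kappa>0$ the series $$g_{f,\kappa}=\sum_{n=0}^\infty \eta_n\,\mathcal L_{f,\kappa}^n b$$ converges in $L^2$ almost surely, the Markov chain has a unique stationary probability measure $\mu_{f,\kappa}$ on the mean-zero functions in $L^2$, and $\mu_{f,\kappa}$ is the law of $g_{f,\kappa}$. (ii) $\Lambda>0$, and there is a constant $C>0$ such that for all $\kappa>0$ and all real $N$ with $2\le N\le\kappa^{-1/2}$ ($C$ being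 independent of $\kappa$ and $N$), $$\frac1{2\Lambda}\log N-C\;\le\;\mathbb E\|\Pi_{\le N}g_{f,\kappa}\|^2\;\le\;\frac2\gamma\log N+C,$$ and, for all $\kappa>0$, $$\mathbb E\|\Pi_{\ge\kappa^{-1/2}}g_{f,\kappa}\|^2\le C,$$ all these expectations being finite. -/

import Mathlib

open MeasureTheory ProbabilityTheory
open scoped NNReal ContDiff

/- The circle `ℝ / ℤ` carries its normalised Haar measure (total mass one), as in Mathlib's theory
of Fourier series on the torus `UnitAddTorus (Fin d) = (ℝ / ℤ)^d`. -/
attribute [local instance] instMeasureSpaceUnitAddCircle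
attribute [local instance] instIsAddHaarMeasureUnitAddCircleVolume
attribute [local instance] instIsProbabilityMeasureUnitAddCircleVolume

namespace PulsedDiffusion

/-- The `d`-dimensional torus `ℝ^d / ℤ^d`. -/
abbrev Torus (d : ℕ) : Type := UnitAddTorus (Fin d)

/-- `ℝ^d` with the Euclidean norm, the universal cover of the torus. -/
abbrev Cover (d : ℕ) : Type := EuclideanSpace ℝ (Fin d)

/-- The covering projection `ℝ^d → ℝ^d / ℤ^d`. -/
def proj {d : ℕ} (x : Cover d) : Torus d := fun i => (x i : UnitAddCircle)

/-- A `C^∞` volume preserving diffeomorphism of the torus: a homeomorphism that preserves the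
Haar measure, such that it and its inverse have `C^∞` lifts to `ℝ^d`. Any two lifts of the same
map differ by an integer translation, so that derivatives do not depend on the lift. -/
structure VolDiffeo (d : ℕ) where
  toHomeomorph : Torus d ≃ₜ Torus d
  lift : Cover d → Cover d
  liftSymm : Cover d → Cover d
  contDiff_lift : ContDiff ℝ ∞ lift
  contDiff_liftSymm : ContDiff ℝ ∞ liftSymm
  proj_lift : ∀ x, toHomeomorph (proj x) = proj (lift x)
  proj_liftSymm : ∀ x, toHomeomorph.symm (proj x) = proj (liftSymm x)
  measurePreserving : MeasurePreserving toHomeomorph volume volume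

/-- `Λ = log sup_x |(Df_x)⁻¹|`, with the operator norm for the Euclidean norm on `ℝ^d`. -/
noncomputable def VolDiffeo.Lam {d : ℕ} (f : VolDiffeo d) : ℝ :=
  Real.log (⨆ x : Cover d, ‖(fderiv ℝ f.lift x).inverse‖)

theorem VolDiffeo.measurePreserving_symm {d : ℕ} (f : VolDiffeo d) :
    MeasurePreserving f.toHomeomorph.symm (volume : Measure (Torus d)) volume :=
  MeasurePreserving.symm f.toHomeomorph.toMeasurableEquiv f.measurePreserving

/-- The complex Hilbert space `L²(𝕋^d)`. -/
abbrev L2 (d : ℕ) : Type := Lp ℂ 2 (volume : Measure (Torus d))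

noncomputable instance (d : ℕ) : MeasurableSpace (L2 d) := borel _

instance (d : ℕ) : BorelSpace (L2 d) := ⟨rfl⟩

/-- `|k|²` for a wavenumber `k ∈ ℤ^d`. -/
def waveSq {d : ℕ} (k : Fin d → ℤ) : ℝ := ∑ i, (k i : ℝ) ^ 2

/-- `|k|`, the Euclidean length of a wavenumber. -/
noncomputable def waveNorm {d : ℕ} (k : Fin d → ℤ) : ℝ := √(waveSq k)

theorem waveSq_nonneg {d : ℕ} (k : Fin d → ℤ) : 0 ≤ waveSq k :=
  Finset.sum_nonneg fun _ _ => sq_nonneg _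

/-- Multiplication of a square summable family by a multiplier bounded by one. -/
noncomputable def diagLp {ι : Type*} (m : ι → ℝ) (hm : ∀ k, |m k| ≤ 1) :
    lp (fun _ : ι => ℂ) 2 →L[ℂ] lp (fun _ : ι => ℂ) 2 :=
  have key : ∀ (a : lp (fun _ : ι => ℂ) 2) (k : ι),
      ‖(m k : ℂ) * a k‖ ≤ ‖a k‖ := fun a k => by
    rw [norm_mul, Complex.norm_real, Real.norm_eq_abs]
    exact mul_le_of_le_one_left (norm_nonneg _) (hm k)
  have mem : ∀ a : lp (fun _ : ι => ℂ) 2,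
      Memℓp (E := fun _ : ι => ℂ) (fun k => (m k : ℂ) * a k) 2 := fun a => by
    have ha := (lp.memℓp a).summable (by norm_num)
    refine memℓp_gen (Summable.of_nonneg_of_le (fun k => by positivity) (fun k => ?_) ha)
    exact Real.rpow_le_rpow (norm_nonneg _) (key a k) (by norm_num)
  LinearMap.mkContinuous
    { toFun := fun a => ⟨fun k => (m k : ℂ) * a k, mem a⟩
      map_add' := fun a b => by
        ext k
        exact mul_add (m k : ℂ) (a k) (b k)
      map_smul' := fun c a => by
        ext k
        exact mul_left_comm (m k : ℂ) c (a k) }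
    1 (fun a => by
      rw [one_mul]
      refine lp.norm_le_of_forall_sum_le (by norm_num) (norm_nonneg _) (fun s => ?_)
      refine (Finset.sum_le_sum fun k _ => ?_).trans (lp.sum_rpow_le_norm_rpow (by norm_num) a s)
      exact Real.rpow_le_rpow (norm_nonneg _) (key a k) (by norm_num))

/-- The Fourier multiplier `∑ ĥ(k) e_k ↦ ∑ m(k) ĥ(k) e_k` on `L²`, for `|m| ≤ 1`. -/
noncomputable def multiplier {d : ℕ} (m : (Fin d → ℤ) → ℝ) (hm : ∀ k, |m k| ≤ 1) :
    L2 d →L[ℂ] L2 d :=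
  (UnitAddTorus.mFourierBasis (d := Fin d)).repr.symm.toContinuousLinearEquiv.toContinuousLinearMap
    ∘L diagLp m hm
    ∘L (UnitAddTorus.mFourierBasis (d := Fin d)).repr.toContinuousLinearEquiv.toContinuousLinearMap

theorem mFourierCoeff_multiplier {d : ℕ} (m : (Fin d → ℤ) → ℝ) (hm : ∀ k, |m k| ≤ 1)
    (h : L2 d) (k : Fin d → ℤ) :
    UnitAddTorus.mFourierCoeff (multiplier m hm h) k
      = (m k : ℂ) * UnitAddTorus.mFourierCoeff h k := by
  rw [← UnitAddTorus.mFourierBasis_repr, ← UnitAddTorus.mFourierBasis_repr]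
  simp only [multiplier, ContinuousLinearMap.comp_apply]
  erw [LinearIsometryEquiv.apply_symm_apply]
  rfl

/-- The heat semigroup `e^{tΔ}`, `t ≥ 0`: since `e_k(x) = e^{2πi k·x}`, it multiplies the `k`-th
Fourier coefficient by `e^{-4π²|k|²t}`. -/
noncomputable def heat {d : ℕ} (t : ℝ≥0) : L2 d →L[ℂ] L2 d :=
  multiplier (fun k => Real.exp (-(4 * Real.pi ^ 2 * waveSq k * t))) (fun k => by
    rw [abs_of_pos (Real.exp_pos _), Real.exp_le_one_iff, neg_nonpos]
    have := waveSq_nonneg k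
    positivity)

open scoped Classical in
/-- The orthogonal projection onto the Fourier modes `k` with `k ∈ S`. -/
noncomputable def modeProj {d : ℕ} (S : Set (Fin d → ℤ)) : L2 d →L[ℂ] L2 d :=
  multiplier (fun k => if k ∈ S then 1 else 0) (fun k => by split_ifs <;> simp)

/-- `Π_{≤ N}`, the projection onto the modes `|k| ≤ N`. -/
noncomputable def projLE {d : ℕ} (N : ℝ) : L2 d →L[ℂ] L2 d := modeProj {k | waveNorm k ≤ N}

/-- `Π_{≥ R}`, the projection onto the modes `|k| ≥ R`. -/
noncomputable def projGE {d : ℕ} (R : ℝ) : L2 d →L[ℂ] L2 d := modeProj {k | R ≤ waveNorm k}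

/-- The transfer operator `φ ↦ φ ∘ f⁻¹` on `L²`. -/
noncomputable def transfer {d : ℕ} (f : VolDiffeo d) : L2 d →L[ℂ] L2 d :=
  (Lp.compMeasurePreservingₗᵢ ℂ f.toHomeomorph.symm
    f.measurePreserving_symm).toContinuousLinearMap

/-- The operator `𝓛_{f,κ} = e^{κΔ} ∘ 𝓛_f`. -/
noncomputable def pulseOp {d : ℕ} (f : VolDiffeo d) (κ : ℝ≥0) : L2 d →L[ℂ] L2 d :=
  heat κ ∘L transfer f

/-- `h` has mean zero. -/
def MeanZero {d : ℕ} (h : L2 d) : Prop := ∫ x, h x = 0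

/-- `h` is (almost everywhere equal to) a `C^∞` function on the torus. -/
def SmoothScalar {d : ℕ} (h : L2 d) : Prop :=
  ∃ φ : Torus d → ℂ, ContDiff ℝ ∞ (fun x : Cover d => φ (proj x)) ∧ h =ᵐ[volume] φ

/-- `h` is real valued. -/
def RealScalar {d : ℕ} (h : L2 d) : Prop := ∀ᵐ x, (h x).im = 0

/-- The homogeneous norm `‖h‖_{H^{-1}} = (∑_{k ≠ 0} |k|^{-2} |ĥ(k)|²)^{1/2}`; the series converges
for every `h` in `L²`. -/
noncomputable def normHNegOne {d : ℕ} (h : L2 d) : ℝ :=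
  √(∑' k : {k : Fin d → ℤ // k ≠ 0},
    (waveNorm k.1 ^ 2)⁻¹ * ‖UnitAddTorus.mFourierCoeff h k.1‖ ^ 2)

/-- `κ`-uniform `H^{-1}` decay at rate `γ`: the constant depends on the scalar `h`, but not on the
diffusivity `κ ≥ 0`. -/
def UniformDecay {d : ℕ} (f : VolDiffeo d) (γ : ℝ) : Prop :=
  ∀ h : L2 d, SmoothScalar h → RealScalar h → MeanZero h →
    ∃ C : ℝ, 0 < C ∧ ∀ (κ : ℝ≥0) (n : ℕ), 1 ≤ n →
      normHNegOne ((pulseOp f κ ^ n) h) ≤ C * Real.exp (-γ * n)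

theorem measurable_map_param {X Y : Type*} [MeasurableSpace X] [MeasurableSpace Y]
    (ν : Measure ℝ) [IsProbabilityMeasure ν] (F : X × ℝ → Y) (hF : Measurable F) :
    Measurable (fun g => ν.map (fun t => F (g, t))) := by
  refine Measure.measurable_of_measurable_coe _ fun s hs => ?_
  have hg : ∀ g : X, Measurable (fun t : ℝ => F (g, t)) := fun g =>
    hF.comp measurable_prodMk_left
  simp_rw [fun g => Measure.map_apply (μ := ν) (hg g) hs]
  exact measurable_measure_prodMk_left (hF hs)

theorem measurable_pulseStep {d : ℕ} (f : VolDiffeo d) (κ : ℝ≥0) (b : L2 d) :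
    Measurable (fun p : L2 d × ℝ => pulseOp f κ p.1 + p.2 • b) := by
  have : Fact ((2 : ENNReal) ≠ ⊤) := ⟨by norm_num⟩
  have h1 : Measurable (fun p : L2 d × ℝ => pulseOp f κ p.1) :=
    (pulseOp f κ).continuous.measurable.comp measurable_fst
  have h2 : Measurable (fun p : L2 d × ℝ => p.2 • b) :=
    (continuous_id.smul continuous_const : Continuous fun t : ℝ => t • b).measurable.comp
      measurable_snd
  exact h1.add h2

/-- The transition kernel of the Markov chain `g_{n+1} = 𝓛_{f,κ} g_n + ω_{n+1} b`, where the
`ω_n` are independent with law `ν`: from `g` the chain moves to a point with the law of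
`𝓛_{f,κ} g + ω b`, `ω ∼ ν`. -/
noncomputable def pulseKernel {d : ℕ} (f : VolDiffeo d) (κ : ℝ≥0) (b : L2 d) (ν : Measure ℝ)
    [IsProbabilityMeasure ν] : Kernel (L2 d) (L2 d) where
  toFun g := ν.map (fun t : ℝ => pulseOp f κ g + t • b)
  measurable' := measurable_map_param ν _ (measurable_pulseStep f κ b)

/-- `μ` is a stationary probability measure, on the mean-zero scalars in `L²`, of the chain. -/
structure Stationary {d : ℕ} (f : VolDiffeo d) (κ : ℝ≥0) (b : L2 d) (ν : Measure ℝ)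
    [IsProbabilityMeasure ν] (μ : Measure (L2 d)) : Prop where
  isProbabilityMeasure : IsProbabilityMeasure μ
  meanZero : ∀ᵐ g ∂μ, MeanZero g
  invariant : (pulseKernel f κ b ν).Invariant μ

/-- The random scalar `g_{f,κ} = ∑_{n ≥ 0} η_n 𝓛_{f,κ}^n b`. -/
noncomputable def statScalar {d : ℕ} (f : VolDiffeo d) (κ : ℝ≥0) (b : L2 d) {Ω : Type*}
    (η : ℕ → Ω → ℝ) (a : Ω) : L2 d :=
  ∑' n, η n a • (pulseOp f κ ^ n) b

end PulsedDiffusion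

open Filter Topology UnitAddTorus

namespace MeasureTheory

/-! The coefficients `η n` are orthonormal in `L²(P)`, so `𝔼‖T g‖² = ∑ ‖T 𝓛ⁿb‖²` for every bounded
real-linear `T` (`hasSum_integral_norm_sq_randomSeries`). Both parts of (ii) thus become statements
about the deterministic orbit `𝓛ⁿb`. Write `S = sup |(Df)⁻¹|`, so `Λ = log S`.

Upper bound: each term `‖Π_{≤N} 𝓛ⁿb‖²` is at most `1`, and `H⁻¹` decay bounds it by `(D N
e^{-γn})²`. About `log N / γ` terms matter; the others form a geometric tail.

Lower bound: `∑ |k|²|ĥ(k)|²` grows by a factor of at most `S²` under composition with `f⁻¹` and does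
not grow under the heat flow. This controls both the energy lost to diffusion, `O(κ S^{2n})`, and
the energy beyond wavenumber `N`, `O(S^{2n}/N²)`. When `κN² ≤ 1`, both are `O(S^{2n}/N²)`, so about
`log N / Λ` terms are close to `1`. These arguments give better coefficients than the stated `2/γ`
and `1/(2Λ)`.

Dissipative range: a heat step removes from the modes `|k| ≥ κ^{-1/2}` at least as much energy as it
leaves there, and the losses telescope.

Positivity of `Λ`: if `S ≤ 1`, then at `κ = 0` the gradient stays bounded and the norm is not lost,
so a fixed amount of energy stays at low modes, against the decay.

Stationarity is read off characteristic functionals. Invariance gives `μ̂(l) = μ̂(l ∘ 𝓛ⁿ) ∏_{k<n}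
ν̂(l 𝓛ᵏb)`. For `κ > 0` the orbit of every mean-zero function tends to `0`, so `μ̂` must equal the
infinite product, which is also the characteristic functional of the random series. -/

theorem ae_summable_and_integrable_tsum_of_nonneg {Ω : Type*} [MeasurableSpace Ω]
    {P : Measure Ω} {F : ℕ → Ω → ℝ} (hF : ∀ n, Integrable (F n) P) (h0 : ∀ n a, 0 ≤ F n a)
    (hs : Summable fun n => ∫ a, F n a ∂P) :
    (∀ᵐ a ∂P, Summable fun n => F n a) ∧ Integrable (fun a => ∑' n, F n a) P := by
  have hm : ∀ n, AEMeasurable (fun a => ENNReal.ofReal (F n a)) P := fun n =>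
    (hF n).1.aemeasurable.ennreal_ofReal
  have hfin : ∫⁻ a, ∑' n, ENNReal.ofReal (F n a) ∂P ≠ ⊤ := by
    rw [lintegral_tsum hm]
    have : ∀ n, ∫⁻ a, ENNReal.ofReal (F n a) ∂P = ENNReal.ofReal (∫ a, F n a ∂P) := fun n =>
      (ofReal_integral_eq_lintegral_ofReal (hF n) (ae_of_all _ (h0 n))).symm
    simp_rw [this]
    exact hs.tsum_ofReal_ne_top
  have hM : AEMeasurable (fun a => ∑' n, ENNReal.ofReal (F n a)) P := AEMeasurable.tsum hm
  have hsum : ∀ᵐ a ∂P, Summable fun n => F n a := by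
    filter_upwards [ae_lt_top' hM hfin] with a ha
    have := ENNReal.summable_toReal ha.ne
    simpa only [ENNReal.toReal_ofReal (h0 _ a)] using this
  refine ⟨hsum, (integrable_toReal_of_lintegral_ne_top hM hfin).congr ?_⟩
  filter_upwards with a
  rw [ENNReal.tsum_toReal_eq (fun n => ENNReal.ofReal_ne_top)]
  simp only [ENNReal.toReal_ofReal (h0 _ a)]

end MeasureTheory

namespace PulsedDiffusion

variable {d : ℕ}

/-! ### Random series with i.i.d. coefficients. -/

section RandomSeries

variable {ν : Measure ℝ} {Ω : Type*} [MeasurableSpace Ω]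
  {P : Measure Ω} {η : ℕ → Ω → ℝ}

theorem memLp_of_hasLaw (hν : MemLp (fun t : ℝ => t) 2 ν) (hη_law : ∀ n, HasLaw (η n) ν P)
    (n : ℕ) : MemLp (η n) 2 P := by
  rw [← (hη_law n).map_eq] at hν
  exact (memLp_map_measure_iff hν.1 (hη_law n).aemeasurable).1 hν

theorem integral_eq_zero_of_hasLaw (hν_mean : ∫ t, t ∂ν = 0)
    (hη_law : ∀ n, HasLaw (η n) ν P) (n : ℕ) : ∫ a, η n a ∂P = 0 := by
  rw [(hη_law n).integral_eq, hν_mean]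

theorem integral_sq_eq_one_of_hasLaw (hν_mean : ∫ t, t ∂ν = 0)
    (hν_var : variance (fun t : ℝ => t) ν = 1)
    (hη_law : ∀ n, HasLaw (η n) ν P) (n : ℕ) : ∫ a, η n a ^ 2 ∂P = 1 := by
  have h1 : Var[η n; P] = 1 := by
    rw [(hη_law n).variance_eq]; exact hν_var
  rwa [variance_of_integral_eq_zero (hη_law n).aemeasurable
    (integral_eq_zero_of_hasLaw hν_mean hη_law n)] at h1

theorem integral_mul_eq_ite (hν_mean : ∫ t, t ∂ν = 0)
    (hν_var : variance (fun t : ℝ => t) ν = 1)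
    (hη_law : ∀ n, HasLaw (η n) ν P) (hη_indep : iIndepFun η P) (i j : ℕ) :
    ∫ a, η i a * η j a ∂P = if i = j then 1 else 0 := by
  split_ifs with h
  · subst h
    simpa only [sq] using integral_sq_eq_one_of_hasLaw hν_mean hν_var hη_law i
  · rw [(hη_indep.indepFun h).integral_fun_mul_eq_mul_integral
      (hη_law i).aemeasurable.aestronglyMeasurable (hη_law j).aemeasurable.aestronglyMeasurable,
      integral_eq_zero_of_hasLaw hν_mean hη_law, zero_mul]

/-- The weighted sum `∑ ‖v n‖ (η n)²` has finite expectation. It serves as the common majorant, both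
for almost sure convergence and for dominated convergence of the second moments. -/
theorem summable_integral_norm_mul_sq {E : Type*} [NormedAddCommGroup E] {v : ℕ → E}
    (hv : Summable fun n => ‖v n‖)
    (hν : MemLp (fun t : ℝ => t) 2 ν) (hν_mean : ∫ t, t ∂ν = 0)
    (hν_var : variance (fun t : ℝ => t) ν = 1) (hη_law : ∀ n, HasLaw (η n) ν P) :
    (∀ᵐ a ∂P, Summable fun n => ‖v n‖ * η n a ^ 2) ∧
      Integrable (fun a => ∑' n, ‖v n‖ * η n a ^ 2) P := by
  refine ae_summable_and_integrable_tsum_of_nonneg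
    (fun n => (memLp_of_hasLaw hν hη_law n).integrable_sq.const_mul _) (fun n a => by positivity) ?_
  simpa only [integral_const_mul, integral_sq_eq_one_of_hasLaw hν_mean hν_var hη_law, mul_one]
    using hv

variable {E : Type*} [NormedAddCommGroup E] [InnerProductSpace ℝ E] {v : ℕ → E}

theorem ae_summable_randomSeries [CompleteSpace E] (hv : Summable fun n => ‖v n‖)
    (hν : MemLp (fun t : ℝ => t) 2 ν) (hν_mean : ∫ t, t ∂ν = 0)
    (hν_var : variance (fun t : ℝ => t) ν = 1) (hη_law : ∀ n, HasLaw (η n) ν P) :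
    ∀ᵐ a ∂P, Summable fun n => η n a • v n := by
  filter_upwards [(summable_integral_norm_mul_sq hv hν hν_mean hν_var hη_law).1] with a ha
  refine Summable.of_norm_bounded (hv.add ha) fun n => ?_
  rw [norm_smul, Real.norm_eq_abs]
  have h1 : |η n a| ≤ 1 + η n a ^ 2 := by
    rw [← sq_abs]; nlinarith [sq_nonneg (|η n a| - 1), abs_nonneg (η n a)]
  nlinarith [norm_nonneg (v n)]

theorem aemeasurable_randomSeries [MeasurableSpace E] [BorelSpace E] [SecondCountableTopology E]
    (hs : ∀ᵐ a ∂P, Summable fun n => η n a • v n) (hη_law : ∀ n, HasLaw (η n) ν P) :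
    AEMeasurable (fun a => ∑' n, η n a • v n) P := by
  refine aemeasurable_of_tendsto_metrizable_ae atTop
    (f := fun n a => ∑ k ∈ Finset.range n, η k a • v k) (fun n => ?_) ?_
  · refine Finset.aemeasurable_fun_sum _ fun k _ => ?_
    exact (hη_law k).aemeasurable.smul_const _
  · filter_upwards [hs] with a ha
    exact ha.hasSum.tendsto_sum_nat

/-- Cauchy–Schwarz with weights `‖v k‖`. The right side increases with `s`, hence is bounded by its
value for the full series. -/
theorem norm_sq_sum_smul_le {F : Type*} [NormedAddCommGroup F] [NormedSpace ℝ F]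
    (T : E →L[ℝ] F) (t : ℕ → ℝ) (s : Finset ℕ) :
    ‖T (∑ k ∈ s, t k • v k)‖ ^ 2 ≤
      ‖T‖ ^ 2 * ((∑ k ∈ s, ‖v k‖) * ∑ k ∈ s, ‖v k‖ * t k ^ 2) := by
  have h1 : ‖T (∑ k ∈ s, t k • v k)‖ ≤ ‖T‖ * ∑ k ∈ s, |t k| * ‖v k‖ := by
    refine (T.le_opNorm _).trans ?_
    gcongr
    refine (norm_sum_le _ _).trans (le_of_eq ?_)
    exact Finset.sum_congr rfl fun k _ => by rw [norm_smul, Real.norm_eq_abs]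
  have h2 : (∑ k ∈ s, |t k| * ‖v k‖) ^ 2 ≤ (∑ k ∈ s, ‖v k‖) * ∑ k ∈ s, ‖v k‖ * t k ^ 2 := by
    refine Finset.sum_sq_le_sum_mul_sum_of_sq_le_mul s (fun _ _ => norm_nonneg _)
      (fun _ _ => by positivity) fun k _ => le_of_eq ?_
    rw [mul_pow, sq_abs]; ring
  calc _ ≤ (‖T‖ * ∑ k ∈ s, |t k| * ‖v k‖) ^ 2 := by gcongr
    _ = ‖T‖ ^ 2 * (∑ k ∈ s, |t k| * ‖v k‖) ^ 2 := by ring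
    _ ≤ _ := by gcongr

theorem integral_norm_sq_sum {F : Type*} [NormedAddCommGroup F] [InnerProductSpace ℝ F]
    (w : ℕ → F) (hν : MemLp (fun t : ℝ => t) 2 ν) (hν_mean : ∫ t, t ∂ν = 0)
    (hν_var : variance (fun t : ℝ => t) ν = 1)
    (hη_law : ∀ n, HasLaw (η n) ν P) (hη_indep : iIndepFun η P) (s : Finset ℕ) :
    ∫ a, ‖∑ k ∈ s, η k a • w k‖ ^ 2 ∂P = ∑ k ∈ s, ‖w k‖ ^ 2 := by
  have h1 : ∀ a, ‖∑ k ∈ s, η k a • w k‖ ^ 2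
      = ∑ i ∈ s, ∑ j ∈ s, η i a * η j a * inner ℝ (w i) (w j) := fun a => by
    rw [← real_inner_self_eq_norm_sq, sum_inner]
    refine Finset.sum_congr rfl fun i _ => ?_
    rw [inner_sum]
    refine Finset.sum_congr rfl fun j _ => ?_
    rw [real_inner_smul_left, real_inner_smul_right, mul_assoc]
  have hint : ∀ i j, Integrable (fun a => η i a * η j a * inner ℝ (w i) (w j)) P := fun i j =>
    ((memLp_of_hasLaw hν hη_law i).integrable_mul (memLp_of_hasLaw hν hη_law j)).mul_const _
  simp_rw [h1]
  rw [integral_finsetSum _ fun i _ => integrable_finsetSum _ fun j _ => hint i j]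
  refine Finset.sum_congr rfl fun i hi => ?_
  rw [integral_finsetSum _ fun j _ => hint i j]
  simp_rw [integral_mul_const, integral_mul_eq_ite hν_mean hν_var hη_law hη_indep, ite_mul,
    one_mul, zero_mul]
  rw [Finset.sum_ite_eq, if_pos hi, real_inner_self_eq_norm_sq]

/-- For partial sums the cross terms vanish by independence and centering; the majorant `G` allows
passage to the limit. -/
theorem hasSum_integral_norm_sq_randomSeries [CompleteSpace E] [MeasurableSpace E] [BorelSpace E]
    [SecondCountableTopology E] {F : Type*} [NormedAddCommGroup F] [InnerProductSpace ℝ F]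
    (T : E →L[ℝ] F) (hv : Summable fun n => ‖v n‖)
    (hν : MemLp (fun t : ℝ => t) 2 ν) (hν_mean : ∫ t, t ∂ν = 0)
    (hν_var : variance (fun t : ℝ => t) ν = 1)
    (hη_law : ∀ n, HasLaw (η n) ν P) (hη_indep : iIndepFun η P) :
    Integrable (fun a => ‖T (∑' n, η n a • v n)‖ ^ 2) P ∧
      HasSum (fun n => ‖T (v n)‖ ^ 2) (∫ a, ‖T (∑' n, η n a • v n)‖ ^ 2 ∂P) := by
  have hs := ae_summable_randomSeries hv hν hν_mean hν_var hη_law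
  obtain ⟨hG, hGi⟩ := summable_integral_norm_mul_sq hv hν hν_mean hν_var hη_law
  set G : Ω → ℝ := fun a => ‖T‖ ^ 2 * ((∑' n, ‖v n‖) * ∑' n, ‖v n‖ * η n a ^ 2) with hGdef
  have hGint : Integrable G P := (hGi.const_mul _).const_mul _
  have hbound : ∀ n, ∀ᵐ a ∂P, ‖‖T (∑ k ∈ Finset.range n, η k a • v k)‖ ^ 2‖ ≤ G a := fun n => by
    filter_upwards [hG] with a ha
    rw [Real.norm_of_nonneg (by positivity)]
    refine (norm_sq_sum_smul_le T (fun k => η k a) _).trans ?_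
    rw [hGdef]
    dsimp only
    gcongr
    · exact hv.sum_le_tsum _ fun _ _ => norm_nonneg _
    · exact ha.sum_le_tsum _ fun _ _ => by positivity
  have hcont : Continuous fun x : E => ‖T x‖ ^ 2 := by fun_prop
  have hlim : ∀ᵐ a ∂P, Tendsto (fun n => ‖T (∑ k ∈ Finset.range n, η k a • v k)‖ ^ 2) atTop
      (𝓝 (‖T (∑' n, η n a • v n)‖ ^ 2)) := by
    filter_upwards [hs] with a ha
    exact (hcont.tendsto _).comp ha.hasSum.tendsto_sum_nat
  have hmeas : ∀ n, AEStronglyMeasurable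
      (fun a => ‖T (∑ k ∈ Finset.range n, η k a • v k)‖ ^ 2) P := fun n => by
    refine hcont.comp_aestronglyMeasurable ?_
    refine Finset.aestronglyMeasurable_fun_sum _ fun k _ => ?_
    exact ((hη_law k).aemeasurable.smul_const _).aestronglyMeasurable
  have hI : Integrable (fun a => ‖T (∑' n, η n a • v n)‖ ^ 2) P := by
    refine hGint.mono' (hcont.comp_aestronglyMeasurable
      (aemeasurable_randomSeries hs hη_law).aestronglyMeasurable) ?_
    filter_upwards [hlim, ae_all_iff.2 hbound] with a h1 h2
    exact le_of_tendsto h1.norm (Eventually.of_forall h2)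
  refine ⟨hI, ?_⟩
  have ht := tendsto_integral_of_dominated_convergence G hmeas hGint hbound hlim
  have he : ∀ n, ∫ a, ‖T (∑ k ∈ Finset.range n, η k a • v k)‖ ^ 2 ∂P
      = ∑ k ∈ Finset.range n, ‖T (v k)‖ ^ 2 := fun n => by
    simp only [map_sum, map_smul]
    exact integral_norm_sq_sum _ hν hν_mean hν_var hη_law hη_indep _
  simp_rw [he] at ht
  exact (hasSum_iff_tendsto_nat_of_nonneg (fun _ => by positivity) _).2 ht

theorem tendsto_prod_charFunDual_randomSeries [IsProbabilityMeasure P] [MeasurableSpace E] [BorelSpace E]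
    [SecondCountableTopology E] (hs : ∀ᵐ a ∂P, Summable fun n => η n a • v n)
    (hη_law : ∀ n, HasLaw (η n) ν P) (hη_indep : iIndepFun η P) (l : StrongDual ℝ E) :
    Tendsto (fun n => ∏ k ∈ Finset.range n, charFun ν (l (v k))) atTop
      (𝓝 (charFunDual (P.map fun a => ∑' n, η n a • v n) l)) := by
  have hmeas := aemeasurable_randomSeries hs hη_law
  have hcont : Continuous fun x : E => Complex.exp (l x * Complex.I) := by fun_prop
  have hpart : ∀ n, AEMeasurable (fun a => ∑ k ∈ Finset.range n, η k a • v k) P := fun n =>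
    Finset.aemeasurable_fun_sum _ fun k _ => (hη_law k).aemeasurable.smul_const _
  have ht : Tendsto
      (fun n => ∫ a, Complex.exp (l (∑ k ∈ Finset.range n, η k a • v k) * Complex.I) ∂P) atTop
      (𝓝 (∫ a, Complex.exp (l (∑' k, η k a • v k) * Complex.I) ∂P)) := by
    refine tendsto_integral_of_dominated_convergence (fun _ => 1)
      (fun n => hcont.comp_aestronglyMeasurable (hpart n).aestronglyMeasurable)
      (integrable_const _) (fun n => ae_of_all _ fun a => ?_) ?_
    · rw [Complex.norm_exp_ofReal_mul_I]
    · filter_upwards [hs] with a ha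
      exact (hcont.tendsto _).comp ha.hasSum.tendsto_sum_nat
  rw [charFunDual_apply, integral_map hmeas hcont.aestronglyMeasurable]
  refine ht.congr fun n => ?_
  have hX : iIndepFun (fun k a => η k a • v k) P :=
    hη_indep.comp (fun k t => t • v k) fun k => measurable_id.smul_const (v k)
  rw [← integral_map (hpart n) (f := fun x => Complex.exp (l x * Complex.I))
    hcont.aestronglyMeasurable, ← charFunDual_apply,
    iIndepFun.charFunDual_map_fun_finsetSum_eq_prod
      (fun k _ => (hη_law k).aemeasurable.smul_const _) (hX.restrict _), Finset.prod_apply]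
  refine Finset.prod_congr rfl fun k _ => ?_
  rw [charFunDual_apply, integral_map ((hη_law k).aemeasurable.smul_const _)
    hcont.aestronglyMeasurable, charFun_apply_real, ← (hη_law k).map_eq,
    integral_map (hη_law k).aemeasurable (by fun_prop)]
  simp only [map_smul, smul_eq_mul, Complex.ofReal_mul, mul_comm]

end RandomSeries

/-! ### Existence and uniqueness of the stationary law. -/

instance (d : ℕ) : SecondCountableTopology (L2 d) :=
  have : Fact ((2 : ENNReal) ≠ ⊤) := ⟨by norm_num⟩
  inferInstance

section Chain

variable {f : VolDiffeo d} {κ : ℝ≥0} {b : L2 d} {ν : Measure ℝ} [IsProbabilityMeasure ν]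

/-- The operator `𝓛_{f,κ}` as a real linear map. -/
noncomputable def realPulseOp (f : VolDiffeo d) (κ : ℝ≥0) : L2 d →L[ℝ] L2 d :=
  (pulseOp f κ).restrictScalars ℝ

theorem realPulseOp_apply (g : L2 d) : realPulseOp f κ g = pulseOp f κ g := rfl

theorem realPulseOp_pow_apply (n : ℕ) (g : L2 d) :
    (realPulseOp f κ ^ n) g = (pulseOp f κ ^ n) g := by
  induction n with
  | zero => rfl
  | succ n ih => simp only [pow_succ', mul_apply_eq_comp, ih, realPulseOp_apply]

theorem bind_pulseKernel (μ : Measure (L2 d)) [SFinite μ] :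
    μ.bind (pulseKernel f κ b ν)
      = (μ.prod ν).map (fun p : L2 d × ℝ => pulseOp f κ p.1 + p.2 • b) := by
  have hm := measurable_pulseStep f κ b
  ext s hs
  rw [Measure.bind_apply hs (pulseKernel f κ b ν).measurable.aemeasurable,
    Measure.map_apply hm hs, Measure.prod_apply (hm hs)]
  refine lintegral_congr fun g => ?_
  exact Measure.map_apply (hm.comp measurable_prodMk_left) hs

theorem charFunDual_bind_pulseKernel (μ : Measure (L2 d)) [SFinite μ] (l : StrongDual ℝ (L2 d)) :
    charFunDual (μ.bind (pulseKernel f κ b ν)) l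
      = charFunDual μ (l ∘L realPulseOp f κ) * charFun ν (l b) := by
  have hcont : Continuous fun x : L2 d => Complex.exp (l x * Complex.I) := by fun_prop
  rw [bind_pulseKernel, charFunDual_apply,
    integral_map (measurable_pulseStep f κ b).aemeasurable hcont.aestronglyMeasurable,
    charFunDual_apply, charFun_apply_real, ← integral_prod_mul]
  refine integral_congr_ae (ae_of_all _ fun p => ?_)
  dsimp only
  rw [← Complex.exp_add, map_add, map_smul]
  congr 1
  simp only [ContinuousLinearMap.comp_apply, realPulseOp_apply, smul_eq_mul]
  push_cast
  ring

theorem charFunDual_eq_of_invariant {μ : Measure (L2 d)} [SFinite μ]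
    (h : (pulseKernel f κ b ν).Invariant μ) (l : StrongDual ℝ (L2 d)) (n : ℕ) :
    charFunDual μ l = charFunDual μ (l ∘L realPulseOp f κ ^ n)
      * ∏ k ∈ Finset.range n, charFun ν (l ((pulseOp f κ ^ k) b)) := by
  induction n with
  | zero => simp [ContinuousLinearMap.one_def]
  | succ n ih =>
    rw [ih]
    have h1 := charFunDual_bind_pulseKernel (f := f) (κ := κ) (b := b) (ν := ν) μ
      (l ∘L realPulseOp f κ ^ n)
    rw [h.def, ContinuousLinearMap.comp_assoc] at h1
    rw [h1, Finset.prod_range_succ, pow_succ, ContinuousLinearMap.comp_apply,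
      realPulseOp_pow_apply]
    rw [ContinuousLinearMap.mul_def]
    ring

/-- The factor `charFunDual μ (l ∘ 𝓛ⁿ)` tends to `1` by dominated convergence, so it is eventually
nonzero and can be divided out. The limit of the products does not involve `μ`, whence uniqueness.
-/
theorem tendsto_charFunDual_of_stationary {μ : Measure (L2 d)} (hμ : Stationary f κ b ν μ)
    (hA : ∀ g : L2 d, MeanZero g → Tendsto (fun n => (pulseOp f κ ^ n) g) atTop (𝓝 0))
    (l : StrongDual ℝ (L2 d)) :
    Tendsto (fun n => ∏ k ∈ Finset.range n, charFun ν (l ((pulseOp f κ ^ k) b))) atTop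
      (𝓝 (charFunDual μ l)) := by
  have := hμ.isProbabilityMeasure
  have h1 : Tendsto (fun n => charFunDual μ (l ∘L realPulseOp f κ ^ n)) atTop (𝓝 1) := by
    have h2 : (1 : ℂ) = ∫ _, (1 : ℂ) ∂μ := by simp
    rw [h2]
    simp_rw [charFunDual_apply]
    refine tendsto_integral_of_dominated_convergence (fun _ => 1)
      (fun n => Continuous.aestronglyMeasurable (by fun_prop)) (integrable_const _)
      (fun n => ae_of_all _ fun g => ?_) ?_
    · rw [Complex.norm_exp_ofReal_mul_I]
    · filter_upwards [hμ.meanZero] with g hg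
      have hc : Continuous fun x : L2 d => Complex.exp (l x * Complex.I) := by fun_prop
      have := (hc.tendsto 0).comp (hA g hg)
      simpa only [Function.comp_def, map_zero, Complex.ofReal_zero, zero_mul, Complex.exp_zero,
        ContinuousLinearMap.comp_apply, realPulseOp_pow_apply] using this
  have hne : ∀ᶠ n in atTop, charFunDual μ (l ∘L realPulseOp f κ ^ n) ≠ 0 :=
    h1.eventually_ne one_ne_zero
  have h3 : Tendsto (fun n => charFunDual μ l / charFunDual μ (l ∘L realPulseOp f κ ^ n)) atTop
      (𝓝 (charFunDual μ l / 1)) := tendsto_const_nhds.div h1 one_ne_zero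
  rw [div_one] at h3
  refine h3.congr' ?_
  filter_upwards [hne] with n hn
  rw [div_eq_iff hn, charFunDual_eq_of_invariant hμ.invariant l n, mul_comm]

theorem Stationary.eq {μ μ' : Measure (L2 d)} (hμ : Stationary f κ b ν μ)
    (hμ' : Stationary f κ b ν μ')
    (hA : ∀ g : L2 d, MeanZero g → Tendsto (fun n => (pulseOp f κ ^ n) g) atTop (𝓝 0)) :
    μ' = μ := by
  have := hμ.isProbabilityMeasure
  have := hμ'.isProbabilityMeasure
  refine Measure.ext_of_charFunDual (funext fun l => ?_)
  exact tendsto_nhds_unique (tendsto_charFunDual_of_stationary hμ' hA l)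
    (tendsto_charFunDual_of_stationary hμ hA l)

/-- One step of the chain prepends the factor `ν̂(l b)` to the product for `l ∘ 𝓛`, which is the
product for `l` with one more term. The hypothesis `hclosed` makes the mean-zero condition
measurable and stable under infinite sums. -/
theorem stationary_map_statScalar {Ω : Type*} [MeasurableSpace Ω] {P : Measure Ω}
    [IsProbabilityMeasure P] {η : ℕ → Ω → ℝ}
    (hs : ∀ᵐ a ∂P, Summable fun n => η n a • (pulseOp f κ ^ n) b)
    (hη_law : ∀ n, HasLaw (η n) ν P) (hη_indep : iIndepFun η P)
    (hmean : ∀ n, MeanZero ((pulseOp f κ ^ n) b))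
    (hclosed : ∃ l : L2 d →L[ℂ] ℂ, ∀ g, MeanZero g ↔ l g = 0) :
    Stationary f κ b ν (P.map (statScalar f κ b η)) := by
  have hmeas : AEMeasurable (statScalar f κ b η) P := aemeasurable_randomSeries hs hη_law
  have hprob : IsProbabilityMeasure (P.map (statScalar f κ b η)) :=
    Measure.isProbabilityMeasure_map hmeas
  refine ⟨hprob, ?_, ?_⟩
  · obtain ⟨m, hm⟩ := hclosed
    simp only [hm] at hmean ⊢
    rw [ae_map_iff hmeas (measurableSet_eq_fun m.continuous.measurable measurable_const)]
    filter_upwards [hs] with a ha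
    rw [statScalar, m.map_tsum ha]
    refine (tsum_congr fun n => ?_).trans tsum_zero
    rw [m.map_smul_of_tower, hmean, smul_zero]
  · have : IsProbabilityMeasure ((P.map (statScalar f κ b η)).bind (pulseKernel f κ b ν)) := by
      rw [bind_pulseKernel]
      exact Measure.isProbabilityMeasure_map (measurable_pulseStep f κ b).aemeasurable
    refine Measure.ext_of_charFunDual (funext fun l => ?_)
    rw [charFunDual_bind_pulseKernel]
    have h1 := tendsto_prod_charFunDual_randomSeries hs hη_law hη_indep l
    have h2 := tendsto_prod_charFunDual_randomSeries hs hη_law hη_indep (l ∘L realPulseOp f κ)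
    refine tendsto_nhds_unique (h2.mul_const (charFun ν (l b))) ?_
    refine ((tendsto_add_atTop_iff_nat 1).2 h1).congr fun n => ?_
    rw [Finset.prod_range_succ']
    simp only [pow_succ', mul_apply_eq_comp, ContinuousLinearMap.comp_apply,
      realPulseOp_apply, pow_zero, one_apply_eq_self]

end Chain

/-! ### Fourier multipliers, the heat step and dissipation. -/

theorem mFourierCoeff_eq_inner (h : L2 d) (k : Fin d → ℤ) :
    mFourierCoeff h k = inner ℂ (mFourierBasis k) h := by
  rw [← mFourierBasis_repr, HilbertBasis.repr_apply_apply]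

theorem continuous_mFourierCoeff (k : Fin d → ℤ) :
    Continuous fun h : L2 d => mFourierCoeff h k := by
  simp_rw [mFourierCoeff_eq_inner]
  fun_prop

theorem hasSum_norm_sq_mFourierCoeff (h : L2 d) :
    HasSum (fun k => ‖mFourierCoeff h k‖ ^ 2) (‖h‖ ^ 2) := by
  have h1 : ∫ t, ‖h t‖ ^ 2 = ‖h‖ ^ 2 := by
    have h2 := L2.inner_def (𝕜 := ℂ) h h
    rw [inner_self_eq_norm_sq_to_K] at h2
    have h3 : ((∫ t, ‖h t‖ ^ 2 : ℝ) : ℂ) = ((‖h‖ ^ 2 : ℝ) : ℂ) := by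
      rw [← integral_complex_ofReal]
      push_cast
      refine Eq.trans ?_ h2.symm
      refine integral_congr_ae (ae_of_all _ fun t => ?_)
      dsimp only
      rw [inner_self_eq_norm_sq_to_K]
      rfl
    exact_mod_cast h3
  rw [← h1]
  exact hasSum_sq_mFourierCoeff h

theorem meanZero_iff (h : L2 d) : MeanZero h ↔ mFourierCoeff h 0 = 0 := by
  unfold MeanZero mFourierCoeff
  simp only [neg_zero, mFourier_zero, ContinuousMap.one_apply, one_smul]

theorem norm_multiplier_sq_le {m : (Fin d → ℤ) → ℝ} (hm : ∀ k, |m k| ≤ 1) {c : ℝ} {h : L2 d}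
    (hc : ∀ k, mFourierCoeff h k ≠ 0 → |m k| ≤ c) :
    ‖multiplier m hm h‖ ^ 2 ≤ c ^ 2 * ‖h‖ ^ 2 := by
  refine hasSum_le (fun k => ?_) (hasSum_norm_sq_mFourierCoeff _)
    ((hasSum_norm_sq_mFourierCoeff h).mul_left (c ^ 2))
  rw [mFourierCoeff_multiplier, norm_mul, mul_pow, Complex.norm_real, Real.norm_eq_abs]
  by_cases h0 : mFourierCoeff h k = 0
  · simp [h0]
  · gcongr
    exact hc k h0

theorem norm_multiplier_le {m : (Fin d → ℤ) → ℝ} (hm : ∀ k, |m k| ≤ 1) {c : ℝ} (h0 : 0 ≤ c)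
    {h : L2 d} (hc : ∀ k, mFourierCoeff h k ≠ 0 → |m k| ≤ c) :
    ‖multiplier m hm h‖ ≤ c * ‖h‖ :=
  le_of_sq_le_sq (by rw [mul_pow]; exact norm_multiplier_sq_le hm hc) (by positivity)

theorem norm_multiplier_le_norm (m : (Fin d → ℤ) → ℝ) (hm : ∀ k, |m k| ≤ 1) (h : L2 d) :
    ‖multiplier m hm h‖ ≤ ‖h‖ := by
  simpa using norm_multiplier_le hm zero_le_one (h := h) fun k _ => hm k

theorem norm_projLE_le (N : ℝ) (h : L2 d) : ‖projLE N h‖ ≤ ‖h‖ := norm_multiplier_le_norm _ _ h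

theorem norm_projGE_le (R : ℝ) (h : L2 d) : ‖projGE R h‖ ≤ ‖h‖ := norm_multiplier_le_norm _ _ h

theorem norm_heat_le (t : ℝ≥0) (h : L2 d) : ‖heat t h‖ ≤ ‖h‖ := norm_multiplier_le_norm _ _ h

theorem mFourierCoeff_heat (t : ℝ≥0) (h : L2 d) (k : Fin d → ℤ) :
    mFourierCoeff (heat t h) k
      = (Real.exp (-(4 * Real.pi ^ 2 * waveSq k * t)) : ℂ) * mFourierCoeff h k := by
  rw [heat, mFourierCoeff_multiplier]

open scoped Classical in
theorem norm_sq_mFourierCoeff_modeProj (S : Set (Fin d → ℤ)) (h : L2 d) (k : Fin d → ℤ) :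
    ‖mFourierCoeff (modeProj S h) k‖ ^ 2 = if k ∈ S then ‖mFourierCoeff h k‖ ^ 2 else 0 := by
  rw [modeProj, mFourierCoeff_multiplier]
  split_ifs <;> simp

theorem waveSq_eq_zero_iff (k : Fin d → ℤ) : waveSq k = 0 ↔ k = 0 := by
  rw [waveSq, Finset.sum_eq_zero_iff_of_nonneg fun _ _ => sq_nonneg _]
  simp [funext_iff]

theorem one_le_waveSq {k : Fin d → ℤ} (hk : k ≠ 0) : 1 ≤ waveSq k := by
  have h1 : waveSq k = ((∑ i, k i ^ 2 : ℤ) : ℝ) := by simp [waveSq]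
  have h2 : 0 < waveSq k := (waveSq_nonneg k).lt_of_ne fun h => hk ((waveSq_eq_zero_iff k).1 h.symm)
  rw [h1] at h2 ⊢
  exact_mod_cast h2

/-- Spectral gap: a nonzero integer vector has `|k| ≥ 1`. -/
theorem norm_heat_le_of_meanZero (t : ℝ≥0) {h : L2 d} (hh : MeanZero h) :
    ‖heat t h‖ ≤ Real.exp (-(4 * Real.pi ^ 2 * t)) * ‖h‖ := by
  refine norm_multiplier_le _ (Real.exp_pos _).le fun k hk => ?_
  have hk0 : k ≠ 0 := by
    rintro rfl
    exact hk ((meanZero_iff h).1 hh)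
  rw [abs_of_pos (Real.exp_pos _), Real.exp_le_exp, neg_le_neg_iff]
  have h1 := one_le_waveSq hk0
  have h2 : (0 : ℝ) ≤ t := t.2
  calc 4 * Real.pi ^ 2 * t = 4 * Real.pi ^ 2 * 1 * t := by ring
    _ ≤ _ := by gcongr

theorem norm_transfer (f : VolDiffeo d) (h : L2 d) : ‖transfer f h‖ = ‖h‖ :=
  (Lp.compMeasurePreservingₗᵢ ℂ f.toHomeomorph.symm f.measurePreserving_symm).norm_map h

theorem coeFn_transfer (f : VolDiffeo d) (h : L2 d) :
    transfer f h =ᵐ[volume] h ∘ f.toHomeomorph.symm :=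
  Lp.coeFn_compMeasurePreserving h f.measurePreserving_symm

theorem MeanZero.transfer {h : L2 d} (hh : MeanZero h) (f : VolDiffeo d) :
    MeanZero (transfer f h) := by
  unfold MeanZero at *
  rw [integral_congr_ae (coeFn_transfer f h), ← hh]
  exact f.measurePreserving_symm.integral_comp f.toHomeomorph.symm.measurableEmbedding h

theorem MeanZero.heat {h : L2 d} (hh : MeanZero h) (t : ℝ≥0) : MeanZero (heat t h) := by
  rw [meanZero_iff] at *
  rw [mFourierCoeff_heat, hh, mul_zero]

theorem MeanZero.pulseOp_pow {h : L2 d} (hh : MeanZero h) (f : VolDiffeo d) (κ : ℝ≥0) (n : ℕ) :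
    MeanZero ((pulseOp f κ ^ n) h) := by
  induction n with
  | zero => exact hh
  | succ n ih =>
    rw [pow_succ', mul_apply_eq_comp]
    exact (ih.transfer f).heat κ

theorem norm_pulseOp_le (f : VolDiffeo d) (κ : ℝ≥0) (h : L2 d) : ‖pulseOp f κ h‖ ≤ ‖h‖ :=
  (norm_heat_le κ _).trans (norm_transfer f h).le

theorem norm_pulseOp_pow_le (f : VolDiffeo d) (κ : ℝ≥0) (n : ℕ) (h : L2 d) :
    ‖(pulseOp f κ ^ n) h‖ ≤ ‖h‖ := by
  induction n with
  | zero => exact le_rfl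
  | succ n ih =>
    rw [pow_succ', mul_apply_eq_comp]
    exact (norm_pulseOp_le f κ _).trans ih

theorem norm_pulseOp_pow_le_of_meanZero (f : VolDiffeo d) (κ : ℝ≥0) {h : L2 d} (hh : MeanZero h)
    (n : ℕ) : ‖(pulseOp f κ ^ n) h‖ ≤ Real.exp (-(4 * Real.pi ^ 2 * κ)) ^ n * ‖h‖ := by
  induction n with
  | zero => simp
  | succ n ih =>
    rw [pow_succ', mul_apply_eq_comp, pow_succ', mul_assoc]
    refine (norm_heat_le_of_meanZero κ ((hh.pulseOp_pow f κ n).transfer f)).trans ?_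
    rw [norm_transfer]
    gcongr

theorem exp_neg_pulse_lt_one {κ : ℝ≥0} (hκ : 0 < κ) : Real.exp (-(4 * Real.pi ^ 2 * κ)) < 1 := by
  have h1 : (0 : ℝ) < κ := hκ
  rw [Real.exp_lt_one_iff, neg_lt_zero]
  positivity

theorem summable_norm_pulseOp_pow (f : VolDiffeo d) {κ : ℝ≥0} (hκ : 0 < κ) {h : L2 d}
    (hh : MeanZero h) : Summable fun n => ‖(pulseOp f κ ^ n) h‖ :=
  Summable.of_nonneg_of_le (fun _ => norm_nonneg _)
    (norm_pulseOp_pow_le_of_meanZero f κ hh)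
    ((summable_geometric_of_lt_one (Real.exp_pos _).le (exp_neg_pulse_lt_one hκ)).mul_right _)

theorem tendsto_pulseOp_pow (f : VolDiffeo d) {κ : ℝ≥0} (hκ : 0 < κ) {h : L2 d}
    (hh : MeanZero h) : Tendsto (fun n => (pulseOp f κ ^ n) h) atTop (𝓝 0) :=
  tendsto_zero_iff_norm_tendsto_zero.2 (summable_norm_pulseOp_pow f hκ hh).tendsto_atTop_zero

/-- The energy lost in one heat step controls the energy in the dissipative modes. -/
theorem norm_sq_projGE_heat_le {κ : ℝ≥0} (hκ : 0 < κ) (h : L2 d) :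
    ‖projGE ((κ : ℝ) ^ (-(1 / 2) : ℝ)) (heat κ h)‖ ^ 2 ≤ ‖h‖ ^ 2 - ‖heat κ h‖ ^ 2 := by
  have hκ' : (0 : ℝ) < κ := hκ
  refine hasSum_le (fun k => ?_) (hasSum_norm_sq_mFourierCoeff _)
    ((hasSum_norm_sq_mFourierCoeff h).sub (hasSum_norm_sq_mFourierCoeff (heat κ h)))
  have hle : ‖mFourierCoeff (heat κ h) k‖ ^ 2
      = Real.exp (-(8 * Real.pi ^ 2 * waveSq k * κ)) * ‖mFourierCoeff h k‖ ^ 2 := by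
    rw [mFourierCoeff_heat, norm_mul, mul_pow, Complex.norm_real,
      Real.norm_of_nonneg (Real.exp_pos _).le, ← Real.exp_nat_mul]
    congr 2
    push_cast
    ring
  have hw := waveSq_nonneg k
  rw [projGE, norm_sq_mFourierCoeff_modeProj, hle]
  split_ifs with hk
  · have h1 : 1 ≤ waveSq k * κ := by
      have h2 : ((κ : ℝ) ^ (-(1 / 2) : ℝ)) ^ 2 ≤ waveSq k := by
        rw [← Real.sq_sqrt hw]
        exact pow_le_pow_left₀ (by positivity) hk 2
      have h3 : ((κ : ℝ) ^ (-(1 / 2) : ℝ)) ^ 2 = (κ : ℝ)⁻¹ := by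
        rw [← Real.rpow_natCast, ← Real.rpow_mul hκ'.le, ← Real.rpow_neg_one]
        norm_num
      rw [h3] at h2
      calc (1 : ℝ) = (κ : ℝ)⁻¹ * κ := by field_simp
        _ ≤ _ := by gcongr
    -- Once at most half of a mode's energy survives, what survives is at most what is lost.
    have h2 : Real.exp (-(8 * Real.pi ^ 2 * waveSq k * κ)) ≤ 1 / 2 := by
      have h3 : (1 : ℝ) ≤ 8 * Real.pi ^ 2 * waveSq k * κ := by
        have := Real.pi_gt_three
        rw [mul_assoc]
        nlinarith
      refine (Real.exp_le_exp.2 (neg_le_neg h3)).trans ?_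
      have := Real.exp_neg_one_lt_d9
      linarith
    nlinarith [sq_nonneg ‖mFourierCoeff h k‖]
  · have h2 : Real.exp (-(8 * Real.pi ^ 2 * waveSq k * κ)) ≤ 1 := by
      rw [Real.exp_le_one_iff, neg_nonpos]
      positivity
    nlinarith [sq_nonneg ‖mFourierCoeff h k‖]

/-- The losses telescope because `transfer` is an isometry. One `‖h‖²` pays for the term `j = 0`,
which has undergone no heat step, and the other for the telescoping sum. -/
theorem sum_norm_sq_projGE_pulseOp_le (f : VolDiffeo d) {κ : ℝ≥0} (hκ : 0 < κ) (h : L2 d)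
    (n : ℕ) : ∑ j ∈ Finset.range n,
      ‖projGE ((κ : ℝ) ^ (-(1 / 2) : ℝ)) ((pulseOp f κ ^ j) h)‖ ^ 2 ≤ 2 * ‖h‖ ^ 2 := by
  have key : ∀ n, ∑ j ∈ Finset.range (n + 1),
      ‖projGE ((κ : ℝ) ^ (-(1 / 2) : ℝ)) ((pulseOp f κ ^ j) h)‖ ^ 2
        ≤ 2 * ‖h‖ ^ 2 - ‖(pulseOp f κ ^ n) h‖ ^ 2 := fun n => by
    induction n with
    | zero =>
      have := pow_le_pow_left₀ (norm_nonneg _)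
        (norm_projGE_le ((κ : ℝ) ^ (-(1 / 2) : ℝ)) h) 2
      simp only [zero_add, Finset.sum_range_one, pow_zero, one_apply_eq_self]
      linarith
    | succ n ih =>
      rw [Finset.sum_range_succ]
      have h1 := norm_sq_projGE_heat_le hκ (transfer f ((pulseOp f κ ^ n) h))
      rw [norm_transfer] at h1
      have h2 : heat κ (transfer f ((pulseOp f κ ^ n) h)) = (pulseOp f κ ^ (n + 1)) h := by
        rw [pow_succ', mul_apply_eq_comp]; rfl
      rw [h2] at h1
      linarith
  rcases n with _ | n
  · simp
  · exact (key n).trans (by linarith [sq_nonneg ‖(pulseOp f κ ^ n) h‖])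

/-- On modes `0 < |k| ≤ N` the weight `|k|⁻²` is at least `N⁻²`; the zero mode, which the `H⁻¹` norm
ignores, is absent. -/
theorem norm_projLE_le_mul_normHNegOne {N : ℝ} (hN : 0 ≤ N) {h : L2 d} (hh : MeanZero h) :
    ‖projLE N h‖ ≤ N * normHNegOne h := by
  have hs := (hasSum_norm_sq_mFourierCoeff h).summable
  have hterm : ∀ k : Fin d → ℤ, k ≠ 0 →
      (waveNorm k ^ 2)⁻¹ * ‖mFourierCoeff h k‖ ^ 2 ≤ ‖mFourierCoeff h k‖ ^ 2 := fun k hk => by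
    refine mul_le_of_le_one_left (by positivity) (inv_le_one_of_one_le₀ ?_)
    rw [waveNorm, Real.sq_sqrt (waveSq_nonneg k)]
    exact one_le_waveSq hk
  have hsum : Summable fun k : {k : Fin d → ℤ // k ≠ 0} =>
      (waveNorm k.1 ^ 2)⁻¹ * ‖mFourierCoeff h k.1‖ ^ 2 :=
    Summable.of_nonneg_of_le (fun k => by positivity) (fun k => hterm k.1 k.2)
      (hs.subtype {k | k ≠ 0})
  refine le_of_sq_le_sq ?_ (mul_nonneg hN (Real.sqrt_nonneg _))
  rw [mul_pow, normHNegOne, Real.sq_sqrt (tsum_nonneg fun k => by positivity), ← tsum_mul_left,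
    ← (hasSum_norm_sq_mFourierCoeff (projLE N h)).tsum_eq]
  have h0 : ∀ k, k ∉ {k : Fin d → ℤ | k ≠ 0} →
      ‖mFourierCoeff (projLE N h) k‖ ^ 2 = 0 := fun k hk => by
    obtain rfl : k = 0 := by simpa using hk
    rw [projLE, norm_sq_mFourierCoeff_modeProj, (meanZero_iff h).1 hh]
    simp
  rw [← tsum_subtype_eq_of_support_subset (s := {k : Fin d → ℤ | k ≠ 0})
    (fun k hk => by by_contra hk'; exact hk (h0 k hk'))]
  refine Summable.tsum_le_tsum (fun k => ?_)
    ((hasSum_norm_sq_mFourierCoeff (projLE N h)).summable.subtype _) (hsum.mul_left _)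
  rw [projLE, norm_sq_mFourierCoeff_modeProj]
  split_ifs with hk
  · have h1 : 0 < waveNorm k.1 := Real.sqrt_pos.2 (zero_lt_one.trans_le (one_le_waveSq k.2))
    have h2 : 1 ≤ N ^ 2 * (waveNorm k.1 ^ 2)⁻¹ := by
      rw [← div_eq_mul_inv, one_le_div (by positivity)]
      exact pow_le_pow_left₀ h1.le hk 2
    rw [← mul_assoc]
    exact le_mul_of_one_le_left (by positivity) h2
  · positivity

/-! ### Lifts to the universal cover and their derivatives. -/

theorem proj_add (x y : Cover d) : proj (x + y) = proj x + proj y := by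
  ext i
  exact AddCircle.coe_add (p := (1 : ℝ)) (x i) (y i)

theorem proj_sub (x y : Cover d) : proj (x - y) = proj x - proj y := by
  ext i
  exact AddCircle.coe_sub (p := (1 : ℝ)) (x i) (y i)

theorem isOpenQuotientMap_proj : IsOpenQuotientMap (proj : Cover d → Torus d) := by
  have h1 : IsOpenQuotientMap (Pi.map fun (_ : Fin d) (t : ℝ) => (t : UnitAddCircle)) :=
    IsOpenQuotientMap.piMap fun _ => QuotientAddGroup.isOpenQuotientMap_mk
  exact h1.comp (EuclideanSpace.equiv (Fin d) ℝ).toHomeomorph.isOpenQuotientMap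

theorem proj_surjective : Function.Surjective (proj : Cover d → Torus d) :=
  isOpenQuotientMap_proj.surjective

theorem continuous_of_continuous_comp_proj {Y : Type*} [TopologicalSpace Y] {q : Torus d → Y}
    (hq : Continuous fun x : Cover d => q (proj x)) : Continuous q :=
  isOpenQuotientMap_proj.isQuotientMap.continuous_iff.2 hq

/-- A continuous map from a connected space into the discrete lattice is constant. -/
theorem exists_eq_const_of_proj_eq_zero {g : Cover d → Cover d} (hg : Continuous g)
    (h : ∀ x, proj (g x) = 0) : ∃ c, ∀ x, g x = c := by
  have key : ∀ i, ∃ c : ℝ, ∀ x, g x i = c := fun i => by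
    have hd : IsDiscrete (Set.range ((↑) : ℤ → ℝ)) :=
      Int.isClosedEmbedding_coe_real.isInducing.isDiscrete_range
    have hc : Continuous fun x => g x i := by fun_prop
    obtain ⟨c, -, hc'⟩ := isPreconnected_univ.eqOn_const_of_mapsTo hd hc.continuousOn
      (fun x _ => by
        obtain ⟨n, hn⟩ := (AddCircle.coe_eq_zero_iff (1 : ℝ)).1 (congrFun (h x) i)
        exact ⟨n, by simpa using hn⟩) ⟨_, 0, rfl⟩
    exact ⟨c, fun x => hc' (Set.mem_univ x)⟩
  choose c hc using key
  exact ⟨WithLp.toLp 2 c, fun x => by ext i; exact hc i x⟩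

theorem VolDiffeo.exists_lift_liftSymm (f : VolDiffeo d) :
    ∃ c, ∀ x, f.lift (f.liftSymm x) = x + c := by
  obtain ⟨c, hc⟩ := exists_eq_const_of_proj_eq_zero
    (g := fun x => f.lift (f.liftSymm x) - x)
    ((f.contDiff_lift.continuous.comp f.contDiff_liftSymm.continuous).sub continuous_id)
    (fun x => by
      rw [proj_sub, ← f.proj_lift, ← f.proj_liftSymm, Homeomorph.apply_symm_apply, sub_self])
  exact ⟨c, fun x => by rw [← hc x]; abel⟩

theorem VolDiffeo.exists_liftSymm_lift (f : VolDiffeo d) :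
    ∃ c, ∀ x, f.liftSymm (f.lift x) = x + c := by
  obtain ⟨c, hc⟩ := exists_eq_const_of_proj_eq_zero
    (g := fun x => f.liftSymm (f.lift x) - x)
    ((f.contDiff_liftSymm.continuous.comp f.contDiff_lift.continuous).sub continuous_id)
    (fun x => by
      rw [proj_sub, ← f.proj_liftSymm, ← f.proj_lift, Homeomorph.symm_apply_apply, sub_self])
  exact ⟨c, fun x => by rw [← hc x]; abel⟩

theorem VolDiffeo.differentiable_lift (f : VolDiffeo d) : Differentiable ℝ f.lift :=
  f.contDiff_lift.differentiable (by simp)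

theorem VolDiffeo.differentiable_liftSymm (f : VolDiffeo d) : Differentiable ℝ f.liftSymm :=
  f.contDiff_liftSymm.differentiable (by simp)

theorem VolDiffeo.fderiv_lift_comp (f : VolDiffeo d) (x : Cover d) :
    fderiv ℝ f.lift (f.liftSymm x) ∘L fderiv ℝ f.liftSymm x = .id ℝ _ := by
  obtain ⟨c, hc⟩ := f.exists_lift_liftSymm
  rw [← fderiv_comp x (f.differentiable_lift _) (f.differentiable_liftSymm _)]
  have : f.lift ∘ f.liftSymm = fun x => x + c := funext hc
  rw [this, fderiv_add_const, fderiv_fun_id]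

theorem _root_.ContinuousLinearMap.inverse_eq_of_comp_eq_id {E : Type*} [NormedAddCommGroup E]
    [NormedSpace ℝ E] [FiniteDimensional ℝ E] {A B : E →L[ℝ] E} (h : A ∘L B = .id ℝ E) :
    A.inverse = B := by
  have h2 : B ∘L A = .id ℝ E := by
    have h3 : (A : E →ₗ[ℝ] E) * (B : E →ₗ[ℝ] E) = 1 := congrArg (fun T : E →L[ℝ] E => (T : E →ₗ[ℝ] E)) h
    ext x
    exact LinearMap.congr_fun (mul_eq_one_comm.1 h3) x
  exact ContinuousLinearMap.inverse_eq h h2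

theorem VolDiffeo.inverse_fderiv_lift (f : VolDiffeo d) (x : Cover d) :
    (fderiv ℝ f.lift (f.liftSymm x)).inverse = fderiv ℝ f.liftSymm x :=
  ContinuousLinearMap.inverse_eq_of_comp_eq_id (f.fderiv_lift_comp x)

theorem VolDiffeo.fderiv_liftSymm_add (f : VolDiffeo d) {m : Cover d} (hm : proj m = 0)
    (x : Cover d) : fderiv ℝ f.liftSymm (x + m) = fderiv ℝ f.liftSymm x := by
  obtain ⟨c, hc⟩ := exists_eq_const_of_proj_eq_zero
    (g := fun x => f.liftSymm (x + m) - f.liftSymm x)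
    ((f.contDiff_liftSymm.continuous.comp (continuous_add_const m)).sub
      f.contDiff_liftSymm.continuous)
    (fun x => by rw [proj_sub, ← f.proj_liftSymm, ← f.proj_liftSymm, proj_add, hm, add_zero,
      sub_self])
  have h1 : (fun x => f.liftSymm (x + m)) = fun x => f.liftSymm x + c :=
    funext fun x => by rw [← hc x]; abel
  rw [← fderiv_comp_add_right, h1, fderiv_add_const]

/-- The derivative is periodic, so its norm descends to the compact torus. Without this bound the
real supremum defining `Λ` could take its default value `0`. -/
theorem VolDiffeo.exists_norm_fderiv_liftSymm_le (f : VolDiffeo d) :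
    ∃ M, ∀ x, ‖fderiv ℝ f.liftSymm x‖ ≤ M := by
  have hcont : Continuous fun x => ‖fderiv ℝ f.liftSymm x‖ :=
    (f.contDiff_liftSymm.continuous_fderiv (by simp)).norm
  let D : Torus d → ℝ := fun θ => ‖fderiv ℝ f.liftSymm (Function.surjInv proj_surjective θ)‖
  have hD : ∀ x, D (proj x) = ‖fderiv ℝ f.liftSymm x‖ := fun x => by
    have h1 : proj (Function.surjInv proj_surjective (proj x) - x) = 0 := by
      rw [proj_sub, Function.surjInv_eq proj_surjective, sub_self]
    have h2 := f.fderiv_liftSymm_add h1 x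
    rw [add_sub_cancel] at h2
    simp only [D, h2]
  have hDc : Continuous D := continuous_of_continuous_comp_proj (by simpa only [hD] using hcont)
  obtain ⟨M, hM⟩ := isCompact_univ.bddAbove_image hDc.continuousOn
  exact ⟨M, fun x => by rw [← hD]; exact hM ⟨_, Set.mem_univ _, rfl⟩⟩

/-- `sup_x |(Df_x)⁻¹|`. -/
noncomputable def VolDiffeo.expLam (f : VolDiffeo d) : ℝ :=
  ⨆ x : Cover d, ‖(fderiv ℝ f.lift x).inverse‖

theorem VolDiffeo.norm_fderiv_liftSymm_le (f : VolDiffeo d) (x : Cover d) :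
    ‖fderiv ℝ f.liftSymm x‖ ≤ f.expLam := by
  obtain ⟨M, hM⟩ := f.exists_norm_fderiv_liftSymm_le
  have hb : BddAbove (Set.range fun x : Cover d => ‖(fderiv ℝ f.lift x).inverse‖) := by
    refine ⟨M, ?_⟩
    rintro _ ⟨y, rfl⟩
    obtain ⟨c, hc⟩ := f.exists_liftSymm_lift
    have h1 := f.inverse_fderiv_lift (f.lift (y - c))
    rw [hc, sub_add_cancel] at h1
    dsimp only
    rw [h1]
    exact hM _
  rw [← f.inverse_fderiv_lift x]
  exact le_ciSup hb (f.liftSymm x)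

theorem VolDiffeo.expLam_nonneg (f : VolDiffeo d) : 0 ≤ f.expLam :=
  Real.iSup_nonneg fun _ => norm_nonneg _

/-! ### Partial derivatives and the Dirichlet energy in Fourier variables. -/

theorem sum_sq_apply_single (φ : StrongDual ℝ (Cover d)) :
    ∑ j, φ (EuclideanSpace.single j 1) ^ 2 = ‖φ‖ ^ 2 := by
  set v := (InnerProductSpace.toDual ℝ (Cover d)).symm φ with hv
  have h1 : ‖v‖ = ‖φ‖ := LinearIsometryEquiv.norm_map _ _
  rw [← h1, EuclideanSpace.norm_sq_eq]
  refine Finset.sum_congr rfl fun j _ => ?_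
  rw [← InnerProductSpace.toDual_symm_apply (y := φ), ← hv, EuclideanSpace.inner_single_right]
  simp

/-- Since `∑ j, φ(M e_j)²` is the squared dual norm of `φ ∘ M`, the operator norm of `M` suffices,
with no dimensional constant. The complex case splits into real and imaginary parts. -/
theorem sum_norm_sq_comp_single_le (A : Cover d →L[ℝ] ℂ) (M : Cover d →L[ℝ] Cover d) :
    ∑ j, ‖A (M (EuclideanSpace.single j 1))‖ ^ 2
      ≤ ‖M‖ ^ 2 * ∑ j, ‖A (EuclideanSpace.single j 1)‖ ^ 2 := by
  have key : ∀ φ : StrongDual ℝ (Cover d), ∑ j, φ (M (EuclideanSpace.single j 1)) ^ 2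
      ≤ ‖M‖ ^ 2 * ∑ j, φ (EuclideanSpace.single j 1) ^ 2 := fun φ => by
    rw [sum_sq_apply_single φ, mul_comm, ← mul_pow]
    refine (sum_sq_apply_single (φ ∘L M)).trans_le ?_
    gcongr
    exact φ.opNorm_comp_le M
  have hsq : ∀ z : ℂ, ‖z‖ ^ 2 = z.re ^ 2 + z.im ^ 2 := fun z => by
    rw [Complex.sq_norm, Complex.normSq_apply]; ring
  simp_rw [hsq, Finset.sum_add_distrib, mul_add]
  exact add_le_add (key (Complex.reCLM ∘L A)) (key (Complex.imCLM ∘L A))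

/-- The partial derivative in the direction `j` of a function on the torus. -/
noncomputable def partialDeriv (q : Torus d → ℂ) (j : Fin d) (θ : Torus d) : ℂ :=
  deriv (fun t : ℝ => q (θ + proj (t • EuclideanSpace.single j 1))) 0

theorem hasDerivAt_line {q : Torus d → ℂ} (hq : ContDiff ℝ 1 fun x : Cover d => q (proj x))
    (x e : Cover d) (s : ℝ) :
    HasDerivAt (fun t : ℝ => q (proj x + proj (t • e)))
      (fderiv ℝ (fun x : Cover d => q (proj x)) (x + s • e) e) s := by
  have h1 : HasDerivAt (fun t : ℝ => x + t • e) e s := by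
    simpa using ((hasDerivAt_id s).smul_const e).const_add x
  have h2 := ((hq.differentiable one_ne_zero (x + s • e)).hasFDerivAt).comp_hasDerivAt s h1
  simpa only [Function.comp_def, proj_add] using h2

theorem partialDeriv_proj {q : Torus d → ℂ} (hq : ContDiff ℝ 1 fun x : Cover d => q (proj x))
    (j : Fin d) (x : Cover d) :
    partialDeriv q j (proj x)
      = fderiv ℝ (fun x : Cover d => q (proj x)) x (EuclideanSpace.single j 1) := by
  have h := (hasDerivAt_line hq x (EuclideanSpace.single j 1) 0).deriv
  rwa [zero_smul, add_zero] at h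

theorem hasDerivAt_partialDeriv {q : Torus d → ℂ}
    (hq : ContDiff ℝ 1 fun x : Cover d => q (proj x)) (j : Fin d) (θ : Torus d) (s : ℝ) :
    HasDerivAt (fun t : ℝ => q (θ + proj (t • EuclideanSpace.single j 1)))
      (partialDeriv q j (θ + proj (s • EuclideanSpace.single j 1))) s := by
  obtain ⟨x, rfl⟩ := proj_surjective θ
  rw [← proj_add, partialDeriv_proj hq]
  exact hasDerivAt_line hq x _ s

theorem continuous_partialDeriv {q : Torus d → ℂ}
    (hq : ContDiff ℝ 1 fun x : Cover d => q (proj x)) (j : Fin d) :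
    Continuous (partialDeriv q j) := by
  refine continuous_of_continuous_comp_proj ?_
  simp_rw [partialDeriv_proj hq]
  exact (hq.continuous_fderiv one_ne_zero).clm_apply continuous_const

theorem continuous_of_contDiff {q : Torus d → ℂ}
    (hq : ContDiff ℝ 1 fun x : Cover d => q (proj x)) : Continuous q :=
  continuous_of_continuous_comp_proj hq.continuous

theorem integrable_of_continuous {E : Type*} [NormedAddCommGroup E] {q : Torus d → E}
    (hq : Continuous q) : Integrable q volume :=
  hq.integrable_of_hasCompactSupport (HasCompactSupport.of_compactSpace q)

/-- The difference quotient of `q` with step `1 / (n + 1)` in the direction `j`. -/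
noncomputable def diffQuot (q : Torus d → ℂ) (j : Fin d) (n : ℕ) (θ : Torus d) : ℂ :=
  ((n : ℂ) + 1) * (q (θ + proj ((1 / ((n : ℝ) + 1)) • EuclideanSpace.single j 1)) - q θ)

theorem continuous_diffQuot {q : Torus d → ℂ} (hq : Continuous q) (j : Fin d) (n : ℕ) :
    Continuous (diffQuot q j n) := by
  unfold diffQuot
  fun_prop

theorem tendsto_nat_mul_sub {φ : ℝ → ℂ} {φ' : ℂ} (h : HasDerivAt φ φ' 0) :
    Tendsto (fun n : ℕ => ((n : ℂ) + 1) * (φ (1 / ((n : ℝ) + 1)) - φ 0)) atTop (𝓝 φ') := by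
  have h1 : Tendsto (fun n : ℕ => 1 / ((n : ℝ) + 1)) atTop (𝓝[≠] 0) := by
    refine tendsto_nhdsWithin_iff.2 ⟨tendsto_one_div_add_atTop_nhds_zero_nat, ?_⟩
    filter_upwards with n
    have : (0 : ℝ) < n + 1 := by positivity
    exact (one_div_pos.2 this).ne'
  refine ((hasDerivAt_iff_tendsto_slope.1 h).comp h1).congr fun n => ?_
  simp only [Function.comp_apply, slope_def_module, sub_zero, one_div, inv_inv]
  rw [← Complex.coe_smul, smul_eq_mul]
  push_cast
  rfl

theorem tendsto_diffQuot {q : Torus d → ℂ} (hq : ContDiff ℝ 1 fun x : Cover d => q (proj x))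
    (j : Fin d) (θ : Torus d) :
    Tendsto (fun n => diffQuot q j n θ) atTop (𝓝 (partialDeriv q j θ)) := by
  have h0 : proj ((0 : ℝ) • EuclideanSpace.single j 1) = (0 : Torus d) := by
    ext i; simp [proj]
  have h1 := hasDerivAt_partialDeriv hq j θ 0
  rw [h0, add_zero] at h1
  have h2 := tendsto_nat_mul_sub h1
  rw [h0, add_zero] at h2
  exact h2

theorem norm_diffQuot_le {q : Torus d → ℂ} (hq : ContDiff ℝ 1 fun x : Cover d => q (proj x))
    {j : Fin d} {M : ℝ} (hM : ∀ θ, ‖partialDeriv q j θ‖ ≤ M) (n : ℕ) (θ : Torus d) :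
    ‖diffQuot q j n θ‖ ≤ M := by
  have h0 : proj ((0 : ℝ) • EuclideanSpace.single j 1) = (0 : Torus d) := by
    ext i; simp [proj]
  have hn : (0 : ℝ) < n + 1 := by positivity
  have h1 := convex_univ.norm_image_sub_le_of_norm_hasDerivWithin_le (s := Set.univ)
    (fun s _ => (hasDerivAt_partialDeriv hq j θ s).hasDerivWithinAt) (fun s _ => hM _)
    (Set.mem_univ (0 : ℝ)) (Set.mem_univ (1 / ((n : ℝ) + 1)))
  rw [h0, add_zero, sub_zero, Real.norm_of_nonneg (by positivity)] at h1
  have h2 : ‖((n : ℂ) + 1)‖ = (n : ℝ) + 1 := by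
    have h3 : ((n : ℂ) + 1) = (((n : ℝ) + 1 : ℝ) : ℂ) := by push_cast; rfl
    rw [h3, Complex.norm_real, Real.norm_of_nonneg hn.le]
  rw [diffQuot, norm_mul, h2]
  calc _ ≤ ((n : ℝ) + 1) * (M * (1 / ((n : ℝ) + 1))) := by gcongr
    _ = M := by field_simp

theorem tendsto_integral_norm_sq_diffQuot {q : Torus d → ℂ}
    (hq : ContDiff ℝ 1 fun x : Cover d => q (proj x)) (j : Fin d) :
    Tendsto (fun n => ∫ θ, ‖diffQuot q j n θ‖ ^ 2) atTop
      (𝓝 (∫ θ, ‖partialDeriv q j θ‖ ^ 2)) := by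
  obtain ⟨M, hM⟩ := isCompact_univ.bddAbove_image (continuous_partialDeriv hq j).norm.continuousOn
  have hM' : ∀ θ, ‖partialDeriv q j θ‖ ≤ M := fun θ => hM ⟨θ, Set.mem_univ _, rfl⟩
  refine tendsto_integral_of_dominated_convergence (fun _ => M ^ 2)
    (fun n => ((continuous_diffQuot (continuous_of_contDiff hq) j n).norm.pow
      2).aestronglyMeasurable) (integrable_const _) (fun n => ae_of_all _ fun θ => ?_)
    (ae_of_all _ fun θ => (tendsto_diffQuot hq j θ).norm.pow 2)
  rw [Real.norm_of_nonneg (by positivity)]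
  exact pow_le_pow_left₀ (norm_nonneg _) (norm_diffQuot_le hq hM' n θ) 2

theorem mFourier_add_arg (k : Fin d → ℤ) (θ v : Torus d) :
    mFourier k (θ + v) = mFourier k θ * mFourier k v := by
  simp only [mFourier, ContinuousMap.coe_mk, Pi.add_apply, ← Finset.prod_mul_distrib]
  refine Finset.prod_congr rfl fun i _ => ?_
  rw [fourier_apply, fourier_apply, fourier_apply, smul_add, AddCircle.toCircle_add,
    Circle.coe_mul]

theorem mFourier_proj (k : Fin d → ℤ) (x : Cover d) :
    mFourier k (proj x) = Complex.exp (∑ i, 2 * Real.pi * Complex.I * k i * x i) := by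
  simp only [mFourier, ContinuousMap.coe_mk, Complex.exp_sum]
  refine Finset.prod_congr rfl fun i _ => ?_
  rw [proj, fourier_coe_apply]
  simp

theorem contDiff_mFourier_proj (k : Fin d → ℤ) {n : WithTop ℕ∞} :
    ContDiff ℝ n fun x : Cover d => mFourier k (proj x) := by
  simp_rw [mFourier_proj]
  refine ContDiff.cexp (ContDiff.sum fun i _ => contDiff_const.mul ?_)
  exact Complex.ofRealCLM.contDiff.comp (EuclideanSpace.proj (𝕜 := ℝ) i).contDiff

theorem hasDerivAt_mFourier_line (k : Fin d → ℤ) (j : Fin d) :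
    HasDerivAt (fun t : ℝ => mFourier k (proj (t • EuclideanSpace.single j 1)))
      (2 * Real.pi * Complex.I * k j) 0 := by
  have h1 : ∀ t : ℝ, mFourier k (proj (t • EuclideanSpace.single j 1))
      = Complex.exp (2 * Real.pi * Complex.I * k j * t) := fun t => by
    rw [mFourier_proj, Finset.sum_eq_single j]
    · simp
    · intro i _ hi
      simp [hi]
    · simp
  simp_rw [h1]
  have h2 : HasDerivAt (fun t : ℝ => 2 * Real.pi * Complex.I * k j * (t : ℂ))
      (2 * Real.pi * Complex.I * k j) 0 := by
    simpa using (Complex.ofRealCLM.hasDerivAt (x := (0 : ℝ))).const_mul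
      (2 * Real.pi * Complex.I * (k j : ℂ))
  simpa using h2.cexp

theorem mFourierCoeff_translate {q : Torus d → ℂ} (v : Torus d) (k : Fin d → ℤ) :
    mFourierCoeff (fun θ => q (θ + v)) k = mFourier k v * mFourierCoeff q k := by
  unfold mFourierCoeff
  rw [← integral_const_mul,
    ← integral_add_right_eq_self (fun θ => mFourier k v * (mFourier (-k) θ • q θ)) v]
  refine integral_congr_ae (ae_of_all _ fun θ => ?_)
  simp only [smul_eq_mul, mFourier_add_arg]
  have h : mFourier k v * mFourier (-k) v = 1 := by
    rw [← mFourier_add, add_neg_cancel, mFourier_zero, ContinuousMap.one_apply]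
  linear_combination (-(mFourier (-k) θ * q (θ + v))) * h

theorem mFourierCoeff_diffQuot {q : Torus d → ℂ} (hq : Continuous q) (j : Fin d) (n : ℕ)
    (k : Fin d → ℤ) : mFourierCoeff (diffQuot q j n) k
      = ((n : ℂ) + 1) * (mFourier k (proj ((1 / ((n : ℝ) + 1)) • EuclideanSpace.single j 1)) - 1)
        * mFourierCoeff q k := by
  have h1 := mFourierCoeff_translate (q := q)
    (proj ((1 / ((n : ℝ) + 1)) • EuclideanSpace.single j 1)) k
  have h2 : mFourierCoeff (diffQuot q j n) k = ((n : ℂ) + 1) *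
      (mFourierCoeff (fun θ => q (θ + proj ((1 / ((n : ℝ) + 1)) • EuclideanSpace.single j 1))) k
        - mFourierCoeff q k) := by
    unfold mFourierCoeff diffQuot
    rw [← integral_sub (integrable_of_continuous (by fun_prop))
      (integrable_of_continuous (by fun_prop)), ← integral_const_mul]
    refine integral_congr_ae (ae_of_all _ fun θ => ?_)
    simp only [smul_eq_mul]
    ring
  rw [h2, h1]
  ring

theorem hasSum_norm_sq_mFourierCoeff_of_continuous {q : Torus d → ℂ} (hq : Continuous q) :
    HasSum (fun k => ‖mFourierCoeff q k‖ ^ 2) (∫ θ, ‖q θ‖ ^ 2) := by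
  have h := hasSum_sq_mFourierCoeff (ContinuousMap.toLp 2 volume ℂ ⟨q, hq⟩ : L2 d)
  simp only [mFourierCoeff_toLp, ContinuousMap.coe_mk] at h
  convert h using 1
  refine integral_congr_ae ?_
  filter_upwards [ContinuousMap.coeFn_toLp (p := 2) (𝕜 := ℂ) (volume : Measure (Torus d))
    ⟨q, hq⟩] with θ hθ
  rw [hθ]
  rfl

theorem tendsto_sum_norm_sq_mFourierCoeff_diffQuot {q : Torus d → ℂ} (hq : Continuous q)
    (j : Fin d) (s : Finset (Fin d → ℤ)) :
    Tendsto (fun n => ∑ k ∈ s, ‖mFourierCoeff (diffQuot q j n) k‖ ^ 2) atTop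
      (𝓝 (∑ k ∈ s, 4 * Real.pi ^ 2 * (k j : ℝ) ^ 2 * ‖mFourierCoeff q k‖ ^ 2)) := by
  refine tendsto_finsetSum _ fun k _ => ?_
  have h1 := tendsto_nat_mul_sub (hasDerivAt_mFourier_line k j)
  have h0 : proj ((0 : ℝ) • EuclideanSpace.single j 1) = (0 : Torus d) := by
    ext i; simp [proj]
  have h00 : mFourier k (0 : Torus d) = 1 := by
    simp [mFourier]
  rw [h0, h00] at h1
  have h2 := (h1.mul_const (mFourierCoeff q k)).norm.pow 2
  simp_rw [mFourierCoeff_diffQuot hq]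
  convert h2 using 2
  rw [norm_mul, mul_pow]
  congr 1
  simp only [norm_mul, Complex.norm_real, Complex.norm_I, Complex.norm_intCast,
    Complex.norm_ofNat, Real.norm_eq_abs, mul_pow, sq_abs]
  norm_num

/-- The Dirichlet energy `∫ |∇q|²`. -/
noncomputable def energy (q : Torus d → ℂ) : ℝ := ∫ θ, ∑ j, ‖partialDeriv q j θ‖ ^ 2

theorem energy_eq_sum {q : Torus d → ℂ} (hq : ContDiff ℝ 1 fun x : Cover d => q (proj x)) :
    energy q = ∑ j, ∫ θ, ‖partialDeriv q j θ‖ ^ 2 :=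
  integral_finsetSum _ fun j _ =>
    integrable_of_continuous ((continuous_partialDeriv hq j).norm.pow 2)

theorem sum_waveSq_eq (q : Torus d → ℂ) (s : Finset (Fin d → ℤ)) :
    4 * Real.pi ^ 2 * ∑ k ∈ s, waveSq k * ‖mFourierCoeff q k‖ ^ 2
      = ∑ j, ∑ k ∈ s, 4 * Real.pi ^ 2 * (k j : ℝ) ^ 2 * ‖mFourierCoeff q k‖ ^ 2 := by
  rw [Finset.sum_comm, Finset.mul_sum]
  refine Finset.sum_congr rfl fun k _ => ?_
  rw [waveSq, Finset.sum_mul, Finset.mul_sum]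
  exact Finset.sum_congr rfl fun j _ => by ring

/-- Bessel's inequality for difference quotients, whose Fourier coefficients are explicit because
translation multiplies them by a character. Letting the step tend to `0` replaces integration by
parts. -/
theorem sum_waveSq_le_energy {q : Torus d → ℂ}
    (hq : ContDiff ℝ 1 fun x : Cover d => q (proj x)) (s : Finset (Fin d → ℤ)) :
    4 * Real.pi ^ 2 * ∑ k ∈ s, waveSq k * ‖mFourierCoeff q k‖ ^ 2 ≤ energy q := by
  have hc := continuous_of_contDiff hq
  rw [sum_waveSq_eq, energy_eq_sum hq]
  refine Finset.sum_le_sum fun j _ => ?_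
  refine le_of_tendsto_of_tendsto' (tendsto_sum_norm_sq_mFourierCoeff_diffQuot hc j s)
    (tendsto_integral_norm_sq_diffQuot hq j) fun n => ?_
  exact sum_le_hasSum s (fun _ _ => by positivity)
    (hasSum_norm_sq_mFourierCoeff_of_continuous (continuous_diffQuot hc j n))

/-- With finitely many frequencies Parseval for the difference quotients is a finite sum, so the
limit can be taken term by term. -/
theorem energy_eq_sum_waveSq {q : Torus d → ℂ}
    (hq : ContDiff ℝ 1 fun x : Cover d => q (proj x)) {s : Finset (Fin d → ℤ)}
    (hs : ∀ k ∉ s, mFourierCoeff q k = 0) :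
    energy q = 4 * Real.pi ^ 2 * ∑ k ∈ s, waveSq k * ‖mFourierCoeff q k‖ ^ 2 := by
  have hc := continuous_of_contDiff hq
  rw [sum_waveSq_eq, energy_eq_sum hq]
  refine Finset.sum_congr rfl fun j _ => ?_
  refine tendsto_nhds_unique ((tendsto_integral_norm_sq_diffQuot hq j).congr fun n => ?_)
    (tendsto_sum_norm_sq_mFourierCoeff_diffQuot hc j s)
  refine (hasSum_norm_sq_mFourierCoeff_of_continuous (continuous_diffQuot hc j n)).unique
    (hasSum_sum_of_ne_finset_zero fun k hk => ?_)
  rw [mFourierCoeff_diffQuot hc, hs k hk]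
  simp

/-! ### Growth of the gradient along the orbit, and the energy left at low modes. -/

theorem contDiff_comp_symm {p : Torus d → ℂ} (hp : ContDiff ℝ 1 fun x : Cover d => p (proj x))
    (f : VolDiffeo d) :
    ContDiff ℝ 1 fun x : Cover d => p (f.toHomeomorph.symm (proj x)) := by
  simp_rw [f.proj_liftSymm]
  exact hp.comp (f.contDiff_liftSymm.of_le (by exact_mod_cast le_top))

/-- Pointwise chain rule, then invariance of volume under the change of variables. -/
theorem energy_comp_symm_le {p : Torus d → ℂ} (hp : ContDiff ℝ 1 fun x : Cover d => p (proj x))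
    (f : VolDiffeo d) :
    energy (fun θ => p (f.toHomeomorph.symm θ)) ≤ f.expLam ^ 2 * energy p := by
  have hq := contDiff_comp_symm hp f
  have hint : ∀ {q : Torus d → ℂ}, (ContDiff ℝ 1 fun x : Cover d => q (proj x)) →
      Continuous fun θ => ∑ j, ‖partialDeriv q j θ‖ ^ 2 := fun h =>
    continuous_finsetSum _ fun j _ => (continuous_partialDeriv h j).norm.pow 2
  have h1 : energy p = ∫ θ, ∑ j, ‖partialDeriv p j (f.toHomeomorph.symm θ)‖ ^ 2 :=
    (f.measurePreserving_symm.integral_comp f.toHomeomorph.symm.measurableEmbedding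
      (fun θ => ∑ j, ‖partialDeriv p j θ‖ ^ 2)).symm
  rw [h1, energy, ← integral_const_mul]
  refine integral_mono (integrable_of_continuous (hint hq)) (integrable_of_continuous
    (continuous_const.mul ((hint hp).comp f.toHomeomorph.symm.continuous))) fun θ => ?_
  obtain ⟨x, rfl⟩ := proj_surjective θ
  dsimp only
  simp_rw [partialDeriv_proj (q := fun θ => p (f.toHomeomorph.symm θ)) hq, f.proj_liftSymm,
    partialDeriv_proj hp]
  have h2 : fderiv ℝ (fun x : Cover d => p (proj (f.liftSymm x))) x
      = fderiv ℝ (fun x : Cover d => p (proj x)) (f.liftSymm x) ∘L fderiv ℝ f.liftSymm x :=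
    fderiv_comp x (hp.differentiable one_ne_zero _) (f.differentiable_liftSymm x)
  simp_rw [h2, ContinuousLinearMap.comp_apply]
  refine (sum_norm_sq_comp_single_le _ _).trans ?_
  gcongr
  exact f.norm_fderiv_liftSymm_le x

/-- `∑ |k|² |ĥ(k)|² ≤ B`. -/
def GradBound (h : L2 d) (B : ℝ) : Prop :=
  ∀ s : Finset (Fin d → ℤ), ∑ k ∈ s, waveSq k * ‖mFourierCoeff h k‖ ^ 2 ≤ B

theorem GradBound.nonneg {h : L2 d} {B : ℝ} (hB : GradBound h B) : 0 ≤ B := by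
  simpa using hB ∅

/-- A bound on all finite partial sums is closed under `L²` convergence, since each involves
finitely many continuous coefficients. -/
theorem GradBound.of_tendsto {ι : Type*} {l : Filter ι} [l.NeBot] {g : ι → L2 d} {h : L2 d} {B : ℝ}
    (hg : ∀ i, GradBound (g i) B) (hl : Tendsto g l (𝓝 h)) : GradBound h B := fun s => by
  refine le_of_tendsto (x := l) (tendsto_finsetSum s fun k _ => ?_) (Eventually.of_forall fun i => hg i s)
  exact ((((continuous_mFourierCoeff k).tendsto h).comp hl).norm.pow 2).const_mul _

theorem SmoothScalar.exists_gradBound {b : L2 d} (hb : SmoothScalar b) :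
    ∃ B, GradBound b B := by
  obtain ⟨φ, hφ, hbφ⟩ := hb
  have hφ1 : ContDiff ℝ 1 fun x : Cover d => φ (proj x) := hφ.of_le (by exact_mod_cast le_top)
  refine ⟨energy φ / (4 * Real.pi ^ 2), fun s => ?_⟩
  rw [le_div_iff₀' (by positivity)]
  have h1 : ∀ k, mFourierCoeff b k = mFourierCoeff φ k := fun k =>
    integral_congr_ae (hbφ.mono fun θ hθ => by simp only [hθ])
  simp_rw [h1]
  exact sum_waveSq_le_energy hφ1 s

/-- The trigonometric polynomial with coefficients `c k`, `k ∈ s`. -/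
noncomputable def trigPoly (s : Finset (Fin d → ℤ)) (c : (Fin d → ℤ) → ℂ) : C(Torus d, ℂ) :=
  ∑ k ∈ s, c k • mFourier k

theorem toLp_trigPoly (s : Finset (Fin d → ℤ)) (c : (Fin d → ℤ) → ℂ) :
    ContinuousMap.toLp 2 volume ℂ (trigPoly s c) = ∑ k ∈ s, c k • mFourierLp 2 k := by
  simp only [trigPoly, map_sum, map_smul]

open scoped Classical in
theorem mFourierCoeff_trigPoly (s : Finset (Fin d → ℤ)) (c : (Fin d → ℤ) → ℂ) (k : Fin d → ℤ) :
    mFourierCoeff (trigPoly s c) k = if k ∈ s then c k else 0 := by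
  rw [← mFourierCoeff_toLp, mFourierCoeff_eq_inner, coe_mFourierBasis, toLp_trigPoly, inner_sum]
  simp only [inner_smul_right, orthonormal_iff_ite.1 orthonormal_mFourier, mul_ite, mul_one,
    mul_zero, Finset.sum_ite_eq]

theorem contDiff_trigPoly (s : Finset (Fin d → ℤ)) (c : (Fin d → ℤ) → ℂ) :
    ContDiff ℝ 1 fun x : Cover d => trigPoly s c (proj x) := by
  simp only [trigPoly, ContinuousMap.coe_sum, ContinuousMap.coe_smul, Finset.sum_apply,
    Pi.smul_apply, smul_eq_mul]
  exact ContDiff.sum fun k _ => contDiff_const.mul (contDiff_mFourier_proj k)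

theorem gradBound_transfer_trigPoly (f : VolDiffeo d) {h : L2 d} {B : ℝ} (hB : GradBound h B)
    (s : Finset (Fin d → ℤ)) :
    GradBound (transfer f (∑ k ∈ s, mFourierCoeff h k • mFourierLp 2 k))
      (f.expLam ^ 2 * B) := fun t => by
  classical
  set p := trigPoly s (mFourierCoeff h) with hp
  have hcd : ContDiff ℝ 1 fun x : Cover d => p (proj x) := contDiff_trigPoly s _
  have h1 : ∀ k, mFourierCoeff (transfer f (∑ k ∈ s, mFourierCoeff h k • mFourierLp 2 k)) k
      = mFourierCoeff (fun θ => p (f.toHomeomorph.symm θ)) k := fun k => by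
    rw [← toLp_trigPoly, ← hp]
    refine integral_congr_ae ?_
    filter_upwards [coeFn_transfer f (ContinuousMap.toLp 2 volume ℂ p),
      f.measurePreserving_symm.quasiMeasurePreserving.ae
        (ContinuousMap.coeFn_toLp (p := 2) (𝕜 := ℂ) (volume : Measure (Torus d)) p)] with θ h2 h3
    rw [h2, Function.comp_apply, h3]
  have h2 := sum_waveSq_le_energy (q := fun θ => p (f.toHomeomorph.symm θ))
    (contDiff_comp_symm hcd f) t
  have h3 := energy_comp_symm_le hcd f
  have h4 := energy_eq_sum_waveSq (q := p) hcd (s := s) fun k hk => by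
    rw [hp, mFourierCoeff_trigPoly, if_neg hk]
  have h5 : ∑ k ∈ s, waveSq k * ‖mFourierCoeff p k‖ ^ 2 ≤ B := by
    refine (Finset.sum_congr rfl fun k hk => ?_).trans_le (hB s)
    rw [hp, mFourierCoeff_trigPoly, if_pos hk]
  simp_rw [h1]
  have h6 : (0 : ℝ) < 4 * Real.pi ^ 2 := by positivity
  refine le_of_mul_le_mul_left ?_ h6
  calc _ ≤ f.expLam ^ 2 * energy p := h2.trans h3
    _ ≤ f.expLam ^ 2 * (4 * Real.pi ^ 2 * B) := by rw [h4]; gcongr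
    _ = _ := by ring

/-- The orbit is only known to lie in `L²`, so the chain rule is applied to the truncated Fourier
series of `h`, which are smooth and obey the same bound `B`, and the estimate passes to the limit.
-/
theorem GradBound.transfer {h : L2 d} {B : ℝ} (hB : GradBound h B) (f : VolDiffeo d) :
    GradBound (transfer f h) (f.expLam ^ 2 * B) :=
  GradBound.of_tendsto (gradBound_transfer_trigPoly f hB)
    (((PulsedDiffusion.transfer f).continuous.tendsto h).comp (hasSum_mFourier_series_L2 h))

theorem GradBound.heat {h : L2 d} {B : ℝ} (hB : GradBound h B) (t : ℝ≥0) :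
    GradBound (heat t h) B := fun s => by
  refine (Finset.sum_le_sum fun k _ => ?_).trans (hB s)
  have h1 := waveSq_nonneg k
  rw [mFourierCoeff_heat, norm_mul, Complex.norm_real, Real.norm_of_nonneg (Real.exp_pos _).le]
  gcongr
  refine mul_le_of_le_one_left (norm_nonneg _) ?_
  rw [Real.exp_le_one_iff, neg_nonpos]
  positivity

theorem GradBound.pulseOp_pow {h : L2 d} {B : ℝ} (hB : GradBound h B) (f : VolDiffeo d)
    (κ : ℝ≥0) (n : ℕ) : GradBound ((pulseOp f κ ^ n) h) ((f.expLam ^ 2) ^ n * B) := by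
  induction n with
  | zero => simpa using hB
  | succ n ih =>
    rw [pow_succ', mul_apply_eq_comp, pow_succ', mul_assoc]
    exact (ih.transfer f).heat κ

theorem GradBound.norm_sq_sub_norm_sq_projLE_le {h : L2 d} {B : ℝ} (hB : GradBound h B) {N : ℝ}
    (hN : 0 < N) : ‖h‖ ^ 2 - ‖projLE N h‖ ^ 2 ≤ B / N ^ 2 := by
  refine hasSum_le_of_sum_le ((hasSum_norm_sq_mFourierCoeff h).sub
    (hasSum_norm_sq_mFourierCoeff (projLE N h))) fun s => ?_
  refine le_trans ?_ (div_le_div_of_nonneg_right (hB s) (sq_nonneg N))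
  rw [Finset.sum_div]
  refine Finset.sum_le_sum fun k _ => ?_
  have hw := waveSq_nonneg k
  rw [projLE, norm_sq_mFourierCoeff_modeProj]
  split_ifs with hk
  · rw [sub_self]
    positivity
  · have h1 : N ^ 2 ≤ waveSq k := by
      rw [← Real.sq_sqrt hw]
      exact pow_le_pow_left₀ hN.le (not_le.1 hk).le 2
    rw [sub_zero, le_div_iff₀ (by positivity), mul_comm]
    gcongr

/-- Each mode loses the fraction `1 - e^{-x} ≤ x` of its energy, with `x = 8π²|k|²t`. -/
theorem GradBound.norm_sq_sub_norm_sq_heat_le {h : L2 d} {B : ℝ} (hB : GradBound h B)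
    (t : ℝ≥0) : ‖h‖ ^ 2 - ‖PulsedDiffusion.heat t h‖ ^ 2 ≤ 8 * Real.pi ^ 2 * t * B := by
  refine hasSum_le_of_sum_le ((hasSum_norm_sq_mFourierCoeff h).sub
    (hasSum_norm_sq_mFourierCoeff (PulsedDiffusion.heat t h))) fun s => ?_
  refine le_trans ?_ (mul_le_mul_of_nonneg_left (hB s)
    (by positivity : (0 : ℝ) ≤ 8 * Real.pi ^ 2 * t))
  rw [Finset.mul_sum]
  refine Finset.sum_le_sum fun k _ => ?_
  rw [mFourierCoeff_heat, norm_mul, mul_pow, Complex.norm_real,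
    Real.norm_of_nonneg (Real.exp_pos _).le, ← Real.exp_nat_mul]
  have h1 := Real.add_one_le_exp (((2 : ℕ) : ℝ) * -(4 * Real.pi ^ 2 * waveSq k * t))
  push_cast at h1 ⊢
  nlinarith [sq_nonneg ‖mFourierCoeff h k‖]

theorem norm_sq_pulseOp_pow_ge (f : VolDiffeo d) {b : L2 d} {B : ℝ} (hB : GradBound b B)
    (κ : ℝ≥0) (n : ℕ) :
    ‖(pulseOp f κ ^ n) b‖ ^ 2 - 8 * Real.pi ^ 2 * κ * ((f.expLam ^ 2) ^ (n + 1) * B)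
      ≤ ‖(pulseOp f κ ^ (n + 1)) b‖ ^ 2 := by
  have h1 := ((hB.pulseOp_pow f κ n).transfer f).norm_sq_sub_norm_sq_heat_le κ
  rw [norm_transfer, ← mul_assoc (f.expLam ^ 2), ← pow_succ'] at h1
  have h2 : heat κ (transfer f ((pulseOp f κ ^ n) b)) = (pulseOp f κ ^ (n + 1)) b := by
    rw [pow_succ', mul_apply_eq_comp]; rfl
  rw [h2] at h1
  linarith

theorem norm_sq_projLE_pulseOp_pow_ge (f : VolDiffeo d) (hS : 1 < f.expLam) {b : L2 d}
    (hb : ‖b‖ = 1) {B : ℝ} (hB : GradBound b B) {κ : ℝ≥0} {N : ℝ} (hN : 0 < N)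
    (hκN : κ * N ^ 2 ≤ 1) (n : ℕ) :
    1 - (B * (1 + 8 * Real.pi ^ 2 * f.expLam ^ 2 / (f.expLam ^ 2 - 1)))
      * ((f.expLam ^ 2) ^ n / N ^ 2) ≤ ‖projLE N ((pulseOp f κ ^ n) b)‖ ^ 2 := by
  have hB0 := hB.nonneg
  set A := f.expLam ^ 2 with hA
  have hA1 : 0 < A - 1 := by rw [hA]; nlinarith
  -- `K` sums the geometric series of heat losses: `K κ Aⁿ⁺¹ - K κ Aⁿ` is exactly the bound on the
  -- loss at step `n + 1`. It is finite because `A > 1`.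
  set K := B * (8 * Real.pi ^ 2 * A / (A - 1)) with hK
  have hK0 : 0 ≤ K := by rw [hK, hA]; positivity
  have hKA : K * (A - 1) = 8 * Real.pi ^ 2 * A * B := by rw [hK]; field_simp
  have key : ∀ n, 1 - K * κ * A ^ n ≤ ‖(pulseOp f κ ^ n) b‖ ^ 2 := fun n => by
    induction n with
    | zero =>
      simp only [pow_zero, one_apply_eq_self, hb, one_pow, mul_one, sub_le_self_iff]
      positivity
    | succ n ih =>
      refine le_trans ?_ (norm_sq_pulseOp_pow_ge f hB κ n)
      have h1 : K * κ * A ^ (n + 1)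
          = K * κ * A ^ n + 8 * Real.pi ^ 2 * κ * (A ^ (n + 1) * B) := by
        rw [pow_succ]
        linear_combination κ * A ^ n * hKA
      linarith
  have h1 := (hB.pulseOp_pow f κ n).norm_sq_sub_norm_sq_projLE_le hN
  have h2 := key n
  have h3 : κ ≤ 1 / N ^ 2 := by rwa [le_div_iff₀ (by positivity)]
  have h4 : K * κ * A ^ n ≤ K * (1 / N ^ 2) * A ^ n := by
    have : 0 ≤ A := by rw [hA]; positivity
    gcongr
  have h5 : B * (1 + 8 * Real.pi ^ 2 * A / (A - 1)) * (A ^ n / N ^ 2)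
      = A ^ n * B / N ^ 2 + K * (1 / N ^ 2) * A ^ n := by
    rw [hK]; ring
  rw [h5]
  linarith

/-! ### Summation over the orbit. -/

theorem hasSum_le_log_div {γ D N U : ℝ} (hγ : 0 < γ) (hN : 1 < N) (hD : 0 ≤ D) {u : ℕ → ℝ}
    (h1 : ∀ n, u n ≤ 1) (h2 : ∀ n, 1 ≤ n → u n ≤ D * (N * Real.exp (-γ * n)) ^ 2)
    (hU : HasSum u U) : U ≤ Real.log N / γ + (1 + D * (1 - Real.exp (-(2 * γ)))⁻¹) := by
  have hL : 0 < Real.log N / γ := div_pos (Real.log_pos hN) hγ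
  set m := ⌈Real.log N / γ⌉₊ with hm
  -- The cutoff must be positive, as the decay bound is unavailable at `n = 0`. From `m` on, `N
  -- e^{-γm} ≤ 1` leaves a geometric tail.
  have hm1 : 1 ≤ m := Nat.one_le_ceil_iff.2 hL
  have hmge : Real.log N / γ ≤ m := Nat.le_ceil _
  have hmle : (m : ℝ) < Real.log N / γ + 1 := Nat.ceil_lt_add_one hL.le
  have hlt : Real.exp (-(2 * γ)) < 1 := by rw [Real.exp_lt_one_iff]; linarith
  have hgeo := (hasSum_geometric_of_lt_one (Real.exp_pos _).le hlt).mul_left D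
  have htail := (hasSum_nat_add_iff' m).2 hU
  have ht : U - ∑ i ∈ Finset.range m, u i ≤ D * (1 - Real.exp (-(2 * γ)))⁻¹ := by
    refine hasSum_le (fun n => ?_) htail hgeo
    refine (h2 (n + m) (by omega)).trans ?_
    gcongr
    have h3 : N * Real.exp (-γ * m) ≤ 1 := by
      rw [← Real.exp_log (zero_lt_one.trans hN), ← Real.exp_add,
        Real.exp_le_one_iff]
      rw [div_le_iff₀ hγ] at hmge
      linarith
    have h4 : (N * Real.exp (-γ * ↑(n + m))) ^ 2
        = (N * Real.exp (-γ * m)) ^ 2 * Real.exp (-(2 * γ)) ^ n := by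
      rw [mul_pow, mul_pow, mul_assoc, ← Real.exp_nat_mul, ← Real.exp_nat_mul,
        ← Real.exp_nat_mul, ← Real.exp_add]
      congr 2
      push_cast
      ring
    rw [h4]
    refine mul_le_of_le_one_left (by positivity) ?_
    exact pow_le_one₀ (mul_nonneg (zero_lt_one.trans hN).le (Real.exp_pos _).le) h3
  have hs : ∑ i ∈ Finset.range m, u i ≤ m := by
    simpa using Finset.sum_le_sum fun i (_ : i ∈ Finset.range m) => h1 i
  linarith

theorem log_div_le_hasSum {S D N U : ℝ} (hS : 1 < S) (hN : 1 < N) (hD : 0 ≤ D) {u : ℕ → ℝ}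
    (h0 : ∀ n, 0 ≤ u n) (h1 : ∀ n, 1 - D * ((S ^ 2) ^ n / N ^ 2) ≤ u n) (hU : HasSum u U) :
    Real.log N / Real.log S - (1 + D * (S ^ 2 - 1)⁻¹) ≤ U := by
  have hlS : 0 < Real.log S := Real.log_pos hS
  have hL : 0 < Real.log N / Real.log S := div_pos (Real.log_pos hN) hlS
  have hS2 : 0 < S ^ 2 - 1 := by nlinarith
  have hN0 : 0 < N := zero_lt_one.trans hN
  set m := ⌊Real.log N / Real.log S⌋₊ with hm
  have hmle : (m : ℝ) ≤ Real.log N / Real.log S := Nat.floor_le hL.le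
  have hmgt : Real.log N / Real.log S < m + 1 := Nat.lt_floor_add_one _
  -- Up to the cutoff the errors `S^{2n}/N²` are dominated by their last term, so their sum is
  -- bounded independently of `N`.
  have hpow : (S ^ 2) ^ m ≤ N ^ 2 := by
    rw [← pow_mul, mul_comm, pow_mul]
    refine pow_le_pow_left₀ (by positivity) ?_ 2
    rw [le_div_iff₀ hlS, ← Real.log_pow] at hmle
    exact (Real.log_le_log_iff (by positivity) hN0).1 hmle
  have hgeo : ∑ n ∈ Finset.range m, D * ((S ^ 2) ^ n / N ^ 2) ≤ D * (S ^ 2 - 1)⁻¹ := by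
    rw [← Finset.mul_sum, ← Finset.sum_div, geom_sum_eq (by linarith)]
    refine mul_le_mul_of_nonneg_left ?_ hD
    rw [div_div, inv_eq_one_div, div_le_div_iff₀ (by positivity) hS2]
    nlinarith
  have hsum : ∑ n ∈ Finset.range m, (1 - D * ((S ^ 2) ^ n / N ^ 2)) ≤ U :=
    (Finset.sum_le_sum fun n _ => h1 n).trans (sum_le_hasSum _ (fun n _ => h0 n) hU)
  rw [Finset.sum_sub_distrib] at hsum
  simp only [Finset.sum_const, Finset.card_range, nsmul_eq_mul, mul_one] at hsum
  linarith

/-! ### Consequences of uniform decay. -/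

theorem exists_decay_of_realScalar {f : VolDiffeo d} {γ : ℝ} (hf : UniformDecay f γ) {h : L2 d}
    (hs : SmoothScalar h) (hr : RealScalar h) (hm : MeanZero h) :
    ∃ D, 0 < D ∧ ∀ (κ : ℝ≥0) (n : ℕ) (N : ℝ), 1 ≤ n → 0 ≤ N →
      ‖projLE N ((pulseOp f κ ^ n) h)‖ ≤ D * (N * Real.exp (-γ * n)) := by
  obtain ⟨D, hD, h1⟩ := hf h hs hr hm
  refine ⟨D, hD, fun κ n N hn hN => ?_⟩
  refine (norm_projLE_le_mul_normHNegOne hN (hm.pulseOp_pow f κ n)).trans ?_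
  calc _ ≤ N * (D * Real.exp (-γ * n)) := by gcongr; exact h1 κ n hn
    _ = _ := by ring

/-- Uniform decay is assumed for real scalars only; complex linearity of `𝓛` transfers it to `b`
through this splitting. -/
theorem SmoothScalar.exists_re_im {b : L2 d} (hb : SmoothScalar b) (hm : MeanZero b) :
    ∃ b₁ b₂ : L2 d, b = b₁ + Complex.I • b₂ ∧ (SmoothScalar b₁ ∧ RealScalar b₁ ∧ MeanZero b₁) ∧
      SmoothScalar b₂ ∧ RealScalar b₂ ∧ MeanZero b₂ := by
  obtain ⟨φ, hφ, hbφ⟩ := hb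
  have hφc : Continuous φ := continuous_of_continuous_comp_proj hφ.continuous
  have hφi : Integrable φ volume := integrable_of_continuous hφc
  have hφ0 : ∫ θ, φ θ = 0 := by rw [← integral_congr_ae hbφ]; exact hm
  have key : ∀ l : ℂ →L[ℝ] ℝ, ∃ g : L2 d, (g =ᵐ[volume] fun θ => (l (φ θ) : ℂ)) ∧
      SmoothScalar g ∧ RealScalar g ∧ MeanZero g := fun l => by
    have hc : Continuous fun θ => (l (φ θ) : ℂ) := by fun_prop
    have hg := ContinuousMap.coeFn_toLp (p := 2) (𝕜 := ℂ) (volume : Measure (Torus d)) ⟨_, hc⟩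
    refine ⟨ContinuousMap.toLp 2 volume ℂ ⟨_, hc⟩, hg, ⟨_, ?_, hg⟩, ?_, ?_⟩
    · exact Complex.ofRealCLM.contDiff.comp (l.contDiff.comp hφ)
    · filter_upwards [hg] with θ hθ
      rw [hθ]
      exact Complex.ofReal_im _
    · rw [MeanZero, integral_congr_ae hg]
      simp only [ContinuousMap.coe_mk]
      rw [integral_complex_ofReal, l.integral_comp_comm hφi, hφ0, map_zero, Complex.ofReal_zero]
  obtain ⟨b₁, h₁, hb₁⟩ := key Complex.reCLM
  obtain ⟨b₂, h₂, hb₂⟩ := key Complex.imCLM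
  refine ⟨b₁, b₂, Lp.ext ?_, hb₁, hb₂⟩
  filter_upwards [hbφ, h₁, h₂, Lp.coeFn_add b₁ (Complex.I • b₂), Lp.coeFn_smul Complex.I b₂]
    with θ e e₁ e₂ e₃ e₄
  rw [e₃, Pi.add_apply, e₄, Pi.smul_apply, e, e₁, e₂, smul_eq_mul, mul_comm]
  exact (Complex.re_add_im _).symm

theorem UniformDecay.exists_norm_projLE_le {f : VolDiffeo d} {γ : ℝ} (hf : UniformDecay f γ)
    {b : L2 d} (hb : SmoothScalar b) (hm : MeanZero b) :
    ∃ D, 0 < D ∧ ∀ (κ : ℝ≥0) (n : ℕ) (N : ℝ), 1 ≤ n → 0 ≤ N →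
      ‖projLE N ((pulseOp f κ ^ n) b)‖ ≤ D * (N * Real.exp (-γ * n)) := by
  obtain ⟨b₁, b₂, rfl, ⟨hs₁, hr₁, hm₁⟩, hs₂, hr₂, hm₂⟩ := hb.exists_re_im hm
  obtain ⟨D₁, hD₁, h₁⟩ := exists_decay_of_realScalar hf hs₁ hr₁ hm₁
  obtain ⟨D₂, hD₂, h₂⟩ := exists_decay_of_realScalar hf hs₂ hr₂ hm₂
  refine ⟨D₁ + D₂, add_pos hD₁ hD₂, fun κ n N hn hN => ?_⟩
  rw [map_add, map_add, map_smul, map_smul, add_mul]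
  refine (norm_add_le _ _).trans (add_le_add (h₁ κ n N hn hN) ?_)
  rw [norm_smul, Complex.norm_I, one_mul]
  exact h₂ κ n N hn hN

/-- Mixing forces expansion. -/
theorem UniformDecay.one_lt_expLam {f : VolDiffeo d} {γ : ℝ} (hγ : 0 < γ) (hf : UniformDecay f γ)
    {b : L2 d} (hb : SmoothScalar b) (hm : MeanZero b) (hb1 : ‖b‖ = 1) : 1 < f.expLam := by
  by_contra! hS
  obtain ⟨B, hB⟩ := hb.exists_gradBound
  obtain ⟨D, hD, hdec⟩ := hf.exists_norm_projLE_le hb hm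
  have hB0 := hB.nonneg
  -- At `κ = 0` the heat loss vanishes, which is why uniform decay must include this case.
  have hnorm : ∀ n, 1 ≤ ‖(pulseOp f 0 ^ n) b‖ ^ 2 := fun n => by
    induction n with
    | zero => simp [hb1]
    | succ n ih =>
      have h1 := norm_sq_pulseOp_pow_ge f hB 0 n
      rw [NNReal.coe_zero, mul_zero, zero_mul, sub_zero] at h1
      exact ih.trans h1
  -- Any `N` with `B / N² < 1` works: a fixed share of the energy then stays below wavenumber `N`
  -- for all `n`.
  set N : ℝ := B + 2 with hNdef
  have hN : 0 < N := by positivity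
  have hle : ∀ n, 1 - B / N ^ 2 ≤ ‖projLE N ((pulseOp f 0 ^ n) b)‖ ^ 2 := fun n => by
    have h1 := (hB.pulseOp_pow f 0 n).norm_sq_sub_norm_sq_projLE_le hN
    have h2 : (f.expLam ^ 2) ^ n * B ≤ B :=
      mul_le_of_le_one_left hB0 (pow_le_one₀ (by positivity) (pow_le_one₀ f.expLam_nonneg hS))
    have h3 : (f.expLam ^ 2) ^ n * B / N ^ 2 ≤ B / N ^ 2 := by gcongr
    linarith [hnorm n]
  have hlim : Tendsto (fun n : ℕ => (D * (N * Real.exp (-γ * n))) ^ 2) atTop (𝓝 0) := by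
    have h1 : Tendsto (fun n : ℕ => Real.exp (-γ * n)) atTop (𝓝 0) :=
      Real.tendsto_exp_atBot.comp
        (tendsto_natCast_atTop_atTop.const_mul_atTop_of_neg (neg_lt_zero.2 hγ))
    simpa using ((h1.const_mul N).const_mul D).pow 2
  have hcontra : 1 - B / N ^ 2 ≤ 0 := by
    refine ge_of_tendsto hlim ?_
    filter_upwards [eventually_ge_atTop 1] with n hn
    exact (hle n).trans (pow_le_pow_left₀ (norm_nonneg _) (hdec 0 n N hn hN.le) 2)
  have : B / N ^ 2 < 1 := by
    rw [div_lt_one (by positivity), hNdef]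
    nlinarith
  linarith

end PulsedDiffusion

/-! ### Assembly. -/

theorem mainTheorem4 {d : ℕ} (f : PulsedDiffusion.VolDiffeo d)
    (γ : ℝ) (hγ : 0 < γ) (hf : PulsedDiffusion.UniformDecay f γ)
    (b : PulsedDiffusion.L2 d) (hb : PulsedDiffusion.SmoothScalar b)
    (hb_mean : PulsedDiffusion.MeanZero b) (hb_norm : ‖b‖ = 1)
    (ν : Measure ℝ) [IsProbabilityMeasure ν] (hν : MemLp (fun t : ℝ => t) 2 ν)
    (hν_mean : ∫ t, t ∂ν = 0) (hν_var : variance (fun t : ℝ => t) ν = 1)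
    {Ω : Type*} [MeasurableSpace Ω] (P : Measure Ω) [IsProbabilityMeasure P]
    (η : ℕ → Ω → ℝ) (hη_law : ∀ n, HasLaw (η n) ν P) (hη_indep : iIndepFun η P) :
    (∀ κ : ℝ≥0, 0 < κ →
      (∀ᵐ a ∂P, Summable fun n => η n a • (PulsedDiffusion.pulseOp f κ ^ n) b) ∧
      ∃ μ : Measure (PulsedDiffusion.L2 d),
        PulsedDiffusion.Stationary f κ b ν μ ∧
        (∀ μ', PulsedDiffusion.Stationary f κ b ν μ' → μ' = μ) ∧
        HasLaw (PulsedDiffusion.statScalar f κ b η) μ P) ∧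
    0 < f.Lam ∧
    ∃ C : ℝ, 0 < C ∧ ∀ κ : ℝ≥0, 0 < κ →
      (∀ N : ℝ, 2 ≤ N → N ≤ (κ : ℝ) ^ (-(1 / 2) : ℝ) →
        Integrable (fun a => ‖PulsedDiffusion.projLE N
          (PulsedDiffusion.statScalar f κ b η a)‖ ^ 2) P ∧
        1 / (2 * f.Lam) * Real.log N - C
          ≤ ∫ a, ‖PulsedDiffusion.projLE N (PulsedDiffusion.statScalar f κ b η a)‖ ^ 2 ∂P ∧
        ∫ a, ‖PulsedDiffusion.projLE N (PulsedDiffusion.statScalar f κ b η a)‖ ^ 2 ∂P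
          ≤ 2 / γ * Real.log N + C) ∧
      Integrable (fun a => ‖PulsedDiffusion.projGE ((κ : ℝ) ^ (-(1 / 2) : ℝ))
        (PulsedDiffusion.statScalar f κ b η a)‖ ^ 2) P ∧
      ∫ a, ‖PulsedDiffusion.projGE ((κ : ℝ) ^ (-(1 / 2) : ℝ))
        (PulsedDiffusion.statScalar f κ b η a)‖ ^ 2 ∂P ≤ C := by
  have hsum : ∀ κ : ℝ≥0, 0 < κ → Summable fun n =>
      ‖(PulsedDiffusion.pulseOp f κ ^ n) b‖ := fun _ hκ =>
    PulsedDiffusion.summable_norm_pulseOp_pow f hκ hb_mean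
  have hLam : f.Lam = Real.log f.expLam := rfl
  have hS := hf.one_lt_expLam hγ hb hb_mean hb_norm
  obtain ⟨B, hB⟩ := hb.exists_gradBound
  obtain ⟨D, hD, hdec⟩ := hf.exists_norm_projLE_le hb hb_mean
  have hB0 := hB.nonneg
  have hlS : 0 < Real.log f.expLam := Real.log_pos hS
  have hS2 : 0 < f.expLam ^ 2 - 1 := by nlinarith
  have hexp : 0 < 1 - Real.exp (-(2 * γ)) := by
    rw [sub_pos, Real.exp_lt_one_iff]; linarith
  set D₁ := B * (1 + 8 * Real.pi ^ 2 * f.expLam ^ 2 / (f.expLam ^ 2 - 1)) with hD₁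
  have hD₁0 : 0 ≤ D₁ := by rw [hD₁]; positivity
  set C₁ := 1 + D ^ 2 * (1 - Real.exp (-(2 * γ)))⁻¹ with hC₁
  set C₂ := 1 + D₁ * (f.expLam ^ 2 - 1)⁻¹ with hC₂
  have hC₁0 : 0 < C₁ := by rw [hC₁]; positivity
  have hC₂0 : 0 < C₂ := by rw [hC₂]; positivity
  -- The three summands serve the upper bound, the lower bound and the dissipative range; none
  -- depends on `κ` or `N`.
  refine ⟨fun κ hκ => ?_, hLam ▸ hlS, C₁ + C₂ + 2, by positivity, fun κ hκ => ⟨?_, ?_⟩⟩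
  · have hs := PulsedDiffusion.ae_summable_randomSeries (hsum κ hκ) hν hν_mean hν_var hη_law
    have hst := PulsedDiffusion.stationary_map_statScalar hs hη_law hη_indep
      (hb_mean.pulseOp_pow f κ) ⟨innerSL ℂ (UnitAddTorus.mFourierBasis 0), fun g => by
        rw [PulsedDiffusion.meanZero_iff, PulsedDiffusion.mFourierCoeff_eq_inner]; rfl⟩
    exact ⟨hs, _, hst, fun μ' hμ' => hst.eq hμ' fun g hg =>
      PulsedDiffusion.tendsto_pulseOp_pow f hκ hg,
      ⟨PulsedDiffusion.aemeasurable_randomSeries hs hη_law, rfl⟩⟩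
  · intro N hN2 hNκ
    have hN : 1 < N := by linarith
    have hκ' : (0 : ℝ) < κ := hκ
    have hκN : κ * N ^ 2 ≤ 1 := by
      have h1 : N ^ 2 ≤ ((κ : ℝ) ^ (-(1 / 2) : ℝ)) ^ 2 := pow_le_pow_left₀ (by linarith) hNκ 2
      rw [← Real.rpow_natCast (_ ^ _), ← Real.rpow_mul hκ'.le] at h1
      norm_num [Real.rpow_neg_one] at h1
      calc κ * N ^ 2 ≤ κ * (κ : ℝ)⁻¹ := by gcongr
        _ = 1 := mul_inv_cancel₀ hκ'.ne'
    obtain ⟨hI, hH⟩ := PulsedDiffusion.hasSum_integral_norm_sq_randomSeries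
      ((PulsedDiffusion.projLE N).restrictScalars ℝ) (hsum κ hκ) hν hν_mean hν_var hη_law hη_indep
    have hlogN : 0 < Real.log N := Real.log_pos hN
    refine ⟨hI, ?_, ?_⟩
    · have h1 := PulsedDiffusion.log_div_le_hasSum hS hN hD₁0 (fun n => sq_nonneg _)
        (PulsedDiffusion.norm_sq_projLE_pulseOp_pow_ge f hS hb_norm hB (by linarith) hκN) hH
      -- The summation gives the coefficient `1 / Λ`; half of it is all that is claimed.
      have h2 : 1 / (2 * f.Lam) * Real.log N ≤ Real.log N / Real.log f.expLam := by
        rw [hLam, one_div_mul_eq_div, div_le_div_iff_of_pos_left hlogN (by positivity) hlS]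
        linarith
      refine le_trans ?_ h1
      linarith
    · have h1 := PulsedDiffusion.hasSum_le_log_div hγ hN (sq_nonneg D) (fun n => ?_)
        (fun n hn => ?_) hH
      · have h2 : Real.log N / γ ≤ 2 / γ * Real.log N := by
          rw [div_mul_eq_mul_div]
          gcongr
          linarith
        refine h1.trans ?_
        linarith
      · refine pow_le_one₀ (norm_nonneg _) ((PulsedDiffusion.norm_projLE_le N _).trans ?_)
        exact (PulsedDiffusion.norm_pulseOp_pow_le f κ n b).trans hb_norm.le
      · rw [← mul_pow]
        exact pow_le_pow_left₀ (norm_nonneg _) (hdec κ n N hn (by linarith)) 2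
  · obtain ⟨hI, hH⟩ := PulsedDiffusion.hasSum_integral_norm_sq_randomSeries
      ((PulsedDiffusion.projGE ((κ : ℝ) ^ (-(1 / 2) : ℝ))).restrictScalars ℝ) (hsum κ hκ)
      hν hν_mean hν_var hη_law hη_indep
    refine ⟨hI, ?_⟩
    have h1 : ∀ n, ∑ j ∈ Finset.range n, ‖PulsedDiffusion.projGE ((κ : ℝ) ^ (-(1 / 2) : ℝ))
        ((PulsedDiffusion.pulseOp f κ ^ j) b)‖ ^ 2 ≤ 2 := fun n => by
      simpa only [hb_norm, one_pow, mul_one] using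
        PulsedDiffusion.sum_norm_sq_projGE_pulseOp_le f hκ b n
    have h2 := le_of_tendsto' hH.tendsto_sum_nat h1
    refine le_trans h2 ?_
    linarith
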